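/- **Setting.** Let $\mathcal X$ be a finite nonempty set of candidate points (e.g. a finite subset of $\mathbb R^d$), $m\ge 1$, $n\ge 0$. Let $h:\mathcal X\to\mathbb R^m$ be a sample of a Gaussian process with mean zero and matrix-valued (positive semidefinite) covariance function $K_0$, let $k_j(x,x')=K_0(x,x')_{jj}$, and let queries at $x_t$ return $y_t=h(x_t)+\epsilon_t$ with $\epsilon_t\sim\mathcal N(0,\sigma^2I_m)$ i.i.d. and independent of $h$, $\sigma>0$. Known functions $g_i:\mathcal X\times\mathbb R^m\to\mathbb R$, $i=0,\dots,n$, satisfy $|g_i(x,y)-g_i(x,z)|\le L_i\|y-z\|_1$. Put $f_i(x)=g_i(x,h(x))$, $\mathcal L=\sum_{i=0}^nL_i$, $[a]^+=\max\{a,0\}$. The problem is to maximize $f_0(x)$ over $x\in\mathcal X$ subject to $f_i(x)\ge0$, $i=1,\dots,n$; when it is feasible, $f_0^\star$ is its optimal value. **Algorithm (CUQB).** Let $\delta\in(0,1)$ and $\alpha_t=6\delta/(\pi^2(t+1)^2(n+1)|\mathcal X|)$. Let $\mu_t(x),\Sigma_t(x)$ be the Gaussian process posterior mean and covariance of $h(x)$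 given $\mathcal D_t=\{(x_s,y_s)\}_{s=1}^t$, and let $u_{i,t}(x)$ be the $(1-\alpha_t/2)$-quantile of $g_i(x,Z)$, $Z\sim\mathcal N(\mu_t(x),\Sigma_t(x))$. For $t=0,1,2,\dots$: declare infeasibility and stop if $\max_{x\in\mathcal X}u_{i,t}(x)<0$ for some $i\in\{1,\dots,n\}$; otherwise query a point $x_{t+1}\in\arg\max\{u_{0,t}(x):x\in\mathcal X,\ u_{i,t}(x)\ge0,\ i=1,\dots,n\}$, chosen as a measurable function of $\mathcal D_t$. **Quantities.** For $t\ge 0$ let $\gamma_{j,t}=\max_{A}\tfrac12\log\det(I+\sigma^{-2}[k_j(a_p,a_q)]_{p,q=1}^t)$ over all $A=(a_1,\dots,a_t)\in\mathcal X^t$ (repetitions allowed), $\gamma_t^{\max}=\max_{1\le j\le m}\gamma_{j,t}$, and $$\Psi_T=\sum_{j=1}^m\sqrt{(T+2)\gamma_{j,T}},\qquad \beta_T=2\log\frac{m\pi^2T^2(n+1)|\mathcal X|}{3\delta}.$$ **Theorem.** 1. As $T\to\infty$, $\dfrac{4\mathcal L\beta_T^{1/2}\Psi_T}{T}=\tilde{\mathcal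 O}\big(\sqrt{\gamma_T^{\max}/T}\big)$, i.e. it is $O\big((\log T)^p\sqrt{\gamma_T^{\max}/T}\big)$ for some $p\in\mathbb N$. 2. Suppose $k_j(x,x)\le1$ for all $j$ and $x$. With probability at least $1-\delta$, the following holds if the problem is feasible: for every $T\ge1$ with $\sigma^2\le1+2/T$, the algorithm performs its first $T$ iterations without declaring infeasibility, and there is a point $\tilde x_T\in\{x_1,\dots,x_T\}$ such that $$f_0^\star-f_0(\tilde x_T)\le\frac{4\mathcal L\beta_T^{1/2}\Psi_T}{T},\qquad [-f_i(\tilde x_T)]^+\le\frac{4\mathcal L\beta_T^{1/2}\Psi_T}{T}\quad(i=1,\dots,n).$$ 3. Without any bound on $k_j$ or $\sigma$, there are constants $C\in\mathbb R$ and $p\in\mathbb N$ that depend on neither $T$ nor the run of the algorithm (including its choice among maximizers), such that, with probability at least $1-\delta$, the following holds if the problem is feasible: for every $T\ge1$, the algorithm performs its first $T$ iterations without declaring infeasibility, and there is a point $\tilde x_T\in\{x_1,\dots,x_T\}$ such that $f_0^\star-f_0(\tilde x_T)$ and all $[-f_i(\tilde x_T)]^+$, $i=1,\dots,n$, are at most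 $C(1+\log T)^p\sqrt{\gamma_T^{\max}/T}$. -/

import Mathlib

open MeasureTheory ProbabilityTheory Matrix

namespace CUQB

noncomputable section

/-! ### Gaussian process posterior

`𝒳` is the finite set of candidate points, `m` the number of outputs of the unknown function `h`,
and `K : 𝒳 → 𝒳 → Matrix (Fin m) (Fin m) ℝ` the matrix-valued prior covariance function:
`K x x' i j` is the prior covariance of `h_i(x)` and `h_j(x')`. The prior mean is zero. -/

/-- Joint prior covariance matrix of the values `h_j(s a)`, indexed by the pairs `(a, j)`. -/
def kernelMatrix {𝒳 ι : Type*} {m : ℕ} (K : 𝒳 → 𝒳 → Matrix (Fin m) (Fin m) ℝ) (s : ι → 𝒳) :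
    Matrix (ι × Fin m) (ι × Fin m) ℝ :=
  Matrix.of fun p q => K (s p.1) (s q.1) p.2 q.2

/-- Prior covariance between `h(x)` and the values `h_j(s a)`. -/
def crossCov {𝒳 ι : Type*} {m : ℕ} (K : 𝒳 → 𝒳 → Matrix (Fin m) (Fin m) ℝ) (s : ι → 𝒳) (x : 𝒳) :
    Matrix (Fin m) (ι × Fin m) ℝ :=
  Matrix.of fun j q => K x (s q.1) j q.2

/-- A data set of `t` pairs (query point, observation). -/
abbrev Data (𝒳 : Type*) (m t : ℕ) : Type _ := Fin t → 𝒳 × (Fin m → ℝ)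

/-- Covariance matrix of the observations in a data set, `K_D + σ² I`. -/
def obsCov {𝒳 : Type*} {m t : ℕ} (K : 𝒳 → 𝒳 → Matrix (Fin m) (Fin m) ℝ) (σ : ℝ)
    (D : Data 𝒳 m t) : Matrix (Fin t × Fin m) (Fin t × Fin m) ℝ :=
  kernelMatrix K (fun a => (D a).1) + σ ^ 2 • (1 : Matrix (Fin t × Fin m) (Fin t × Fin m) ℝ)

/-- Posterior mean `μ_t(x) = K(x, D) (K_D + σ² I)⁻¹ y`. -/
def postMean {𝒳 : Type*} {m t : ℕ} (K : 𝒳 → 𝒳 → Matrix (Fin m) (Fin m) ℝ) (σ : ℝ)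
    (D : Data 𝒳 m t) (x : 𝒳) : Fin m → ℝ :=
  (crossCov K (fun a => (D a).1) x * (obsCov K σ D)⁻¹) *ᵥ (fun p => (D p.1).2 p.2)

/-- Posterior covariance `Σ_t(x) = K(x, x) - K(x, D) (K_D + σ² I)⁻¹ K(x, D)ᵀ`. -/
def postCov {𝒳 : Type*} {m t : ℕ} (K : 𝒳 → 𝒳 → Matrix (Fin m) (Fin m) ℝ) (σ : ℝ)
    (D : Data 𝒳 m t) (x : 𝒳) : Matrix (Fin m) (Fin m) ℝ :=
  K x x - crossCov K (fun a => (D a).1) x * (obsCov K σ D)⁻¹ *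
    (crossCov K (fun a => (D a).1) x)ᵀ

/-! ### Quantile bounds -/

/-- Quantile function of a probability measure on `ℝ`: `Q(p) = inf {y | F(y) ≥ p}`. -/
def quantile (ν : Measure ℝ) (p : ℝ) : ℝ := sInf {y : ℝ | p ≤ cdf ν y}

/-- Law of `Y_t(x) = φ(Z)` with `Z ∼ N(μ_t(x), Σ_t(x))`, where `φ` will be `g_i(x, ·)`. -/
def predLaw {𝒳 : Type*} {m t : ℕ} (K : 𝒳 → 𝒳 → Matrix (Fin m) (Fin m) ℝ) (σ : ℝ)
    (D : Data 𝒳 m t) (x : 𝒳) (φ : (Fin m → ℝ) → ℝ) : Measure ℝ :=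
  (multivariateGaussian (WithLp.toLp 2 (postMean K σ D x)) (postCov K σ D x)).map
    (fun z => φ (WithLp.ofLp z))

/-- The probability level `α_{i,t} = 6δ / (π² (t+1)² (n+1) |𝒳|)`, which does not depend on `i`. -/
def level (𝒳 : Type*) [Fintype 𝒳] (n : ℕ) (δ : ℝ) (t : ℕ) : ℝ :=
  6 * δ / (Real.pi ^ 2 * ((t : ℝ) + 1) ^ 2 * ((n : ℝ) + 1) * (Fintype.card 𝒳 : ℝ))

/-- Upper quantile bound `u_{i,t}(x) = Q_{Y_{i,t}(x)}(1 - α_{i,t}/2)`. The functions `g_i` are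
indexed by `Fin (n + 1)`: `g 0` gives the objective and `g i.succ`, `i : Fin n`, the constraints. -/
def upper {𝒳 : Type*} [Fintype 𝒳] {m n t : ℕ} (K : 𝒳 → 𝒳 → Matrix (Fin m) (Fin m) ℝ) (σ δ : ℝ)
    (g : Fin (n + 1) → 𝒳 → (Fin m → ℝ) → ℝ) (D : Data 𝒳 m t) (i : Fin (n + 1)) (x : 𝒳) : ℝ :=
  quantile (predLaw K σ D x (g i x)) (1 - level 𝒳 n δ t / 2)

/-! ### The algorithm -/

/-- The infeasibility test: some constraint `i` has `max_x u_{i,t}(x) < 0`. -/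
def DeclaresInfeasible {𝒳 : Type*} [Fintype 𝒳] {m n t : ℕ}
    (K : 𝒳 → 𝒳 → Matrix (Fin m) (Fin m) ℝ) (σ δ : ℝ)
    (g : Fin (n + 1) → 𝒳 → (Fin m → ℝ) → ℝ) (D : Data 𝒳 m t) : Prop :=
  ∃ i : Fin n, ∀ x, upper K σ δ g D i.succ x < 0

/-- `x` is feasible for the auxiliary problem: `u_{i,t}(x) ≥ 0` for all constraints. -/
def AuxFeasible {𝒳 : Type*} [Fintype 𝒳] {m n t : ℕ}
    (K : 𝒳 → 𝒳 → Matrix (Fin m) (Fin m) ℝ) (σ δ : ℝ)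
    (g : Fin (n + 1) → 𝒳 → (Fin m → ℝ) → ℝ) (D : Data 𝒳 m t) (x : 𝒳) : Prop :=
  ∀ i : Fin n, 0 ≤ upper K σ δ g D i.succ x

/-- `x` is a global maximizer of `u_{0,t}` subject to `u_{i,t} ≥ 0` for all constraints. -/
def SolvesAux {𝒳 : Type*} [Fintype 𝒳] {m n t : ℕ}
    (K : 𝒳 → 𝒳 → Matrix (Fin m) (Fin m) ℝ) (σ δ : ℝ)
    (g : Fin (n + 1) → 𝒳 → (Fin m → ℝ) → ℝ) (D : Data 𝒳 m t) (x : 𝒳) : Prop :=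
  AuxFeasible K σ δ g D x ∧
    ∀ x', AuxFeasible K σ δ g D x' → upper K σ δ g D 0 x' ≤ upper K σ δ g D 0 x

/-- A query rule `π`, giving `x_{t+1} = π t D_t`, follows CUQB: it is a measurable function of the
data and returns a maximizer of the auxiliary problem whenever that problem is feasible. Its value
is irrelevant otherwise (the algorithm has then no next query). -/
structure IsCUQBRule {𝒳 : Type*} [Fintype 𝒳] [MeasurableSpace 𝒳] {m n : ℕ}
    (K : 𝒳 → 𝒳 → Matrix (Fin m) (Fin m) ℝ) (σ δ : ℝ)
    (g : Fin (n + 1) → 𝒳 → (Fin m → ℝ) → ℝ) (rule : (t : ℕ) → Data 𝒳 m t → 𝒳) : Prop where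
  measurable : ∀ t, Measurable (rule t)
  solves : ∀ (t : ℕ) (D : Data 𝒳 m t), (∃ x, AuxFeasible K σ δ g D x) →
    SolvesAux K σ δ g D (rule t D)

/-- The data `D_t` generated by a query rule when the unknown function is `h` and the noise vectors
are `e 0, e 1, …`: `D_{t+1}` appends `(x_{t+1}, h(x_{t+1}) + e t)` to `D_t`. -/
def history {𝒳 : Type*} {m : ℕ} (rule : (t : ℕ) → Data 𝒳 m t → 𝒳) (h : 𝒳 → Fin m → ℝ)
    (e : ℕ → Fin m → ℝ) : (t : ℕ) → Data 𝒳 m t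
  | 0 => Fin.elim0
  | t + 1 => Fin.snoc (history rule h e t)
      (rule t (history rule h e t), h (rule t (history rule h e t)) + e t)

/-- `query rule h e t` is the point `x_{t+1}`. -/
def query {𝒳 : Type*} {m : ℕ} (rule : (t : ℕ) → Data 𝒳 m t → 𝒳) (h : 𝒳 → Fin m → ℝ)
    (e : ℕ → Fin m → ℝ) (t : ℕ) : 𝒳 :=
  rule t (history rule h e t)

/-- The random function `h` is a centred Gaussian process on `𝒳` with covariance function `K`, and
the noise vectors `ε 0, ε 1, …` are i.i.d. `N(0, σ² I_m)` and independent of `h`. -/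
structure IsGPModel {𝒳 : Type*} [Fintype 𝒳] [DecidableEq 𝒳] {m : ℕ} {Ω : Type*}
    [MeasurableSpace Ω] (μ : Measure Ω) (K : 𝒳 → 𝒳 → Matrix (Fin m) (Fin m) ℝ) (σ : ℝ)
    (h : Ω → 𝒳 → Fin m → ℝ) (ε : ℕ → Ω → Fin m → ℝ) : Prop where
  measurable_h : Measurable h
  measurable_noise : ∀ t, Measurable (ε t)
  law_h : HasLaw (fun ω => WithLp.toLp 2 (fun p : 𝒳 × Fin m => h ω p.1 p.2))
    (multivariateGaussian 0 (kernelMatrix K id)) μ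
  law_noise : ∀ t j, HasLaw (fun ω => ε t ω j) (gaussianReal 0 (Real.toNNReal (σ ^ 2))) μ
  indep_noise : iIndepFun (fun (p : ℕ × Fin m) (ω : Ω) => ε p.1 ω p.2) μ
  indep_h_noise : IndepFun h (fun ω t => ε t ω) μ

/-! ### The original problem -/

/-- `x` is feasible for the original problem: `f_i(x) = g_i(x, h(x)) ≥ 0` for all constraints. -/
def IsFeasible {𝒳 : Type*} {m n : ℕ} (g : Fin (n + 1) → 𝒳 → (Fin m → ℝ) → ℝ)
    (h : 𝒳 → Fin m → ℝ) (x : 𝒳) : Prop :=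
  ∀ i : Fin n, 0 ≤ g i.succ x (h x)

/-- The optimal value `f_0^⋆`, the maximum of `f_0` over the (finite) set of feasible points. -/
def optValue {𝒳 : Type*} {m n : ℕ} (g : Fin (n + 1) → 𝒳 → (Fin m → ℝ) → ℝ)
    (h : 𝒳 → Fin m → ℝ) : ℝ :=
  sSup ((fun x => g 0 x (h x)) '' {x | IsFeasible g h x})

/-- The algorithm performs its first `T` iterations (never declaring infeasibility, and querying a
solution of the auxiliary problem each time), and one of the points `x_1, …, x_T` has regret at
most `b` and all its constraint violations at most `b`. -/
def FindsWithin {𝒳 : Type*} [Fintype 𝒳] {m n : ℕ} (K : 𝒳 → 𝒳 → Matrix (Fin m) (Fin m) ℝ)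
    (σ δ : ℝ) (g : Fin (n + 1) → 𝒳 → (Fin m → ℝ) → ℝ) (rule : (t : ℕ) → Data 𝒳 m t → 𝒳)
    (h : 𝒳 → Fin m → ℝ) (e : ℕ → Fin m → ℝ) (T : ℕ) (b : ℝ) : Prop :=
  (∀ t < T, ¬ DeclaresInfeasible K σ δ g (history rule h e t) ∧
    SolvesAux K σ δ g (history rule h e t) (query rule h e t)) ∧
  ∃ t < T,
    optValue g h - g 0 (query rule h e t) (h (query rule h e t)) ≤ b ∧
    ∀ i : Fin n, max (-(g i.succ (query rule h e t) (h (query rule h e t)))) 0 ≤ b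

/-! ### Quantities in the rate -/

/-- Maximum information gain `γ_{j,t}` about the `j`-th output from `t` noisy measurements:
the maximum of `½ log det (I + σ⁻² K_{j,A})` over all choices `A` of `t` points of `𝒳`. A point may
be measured repeatedly, so that `γ_{j,t}` is meaningful for every `t`. -/
def infoGain {𝒳 : Type*} {m : ℕ} (K : 𝒳 → 𝒳 → Matrix (Fin m) (Fin m) ℝ) (σ : ℝ) (j : Fin m)
    (t : ℕ) : ℝ :=
  ⨆ A : Fin t → 𝒳, (1 / 2 : ℝ) * Real.log
    ((1 + (σ ^ 2)⁻¹ • Matrix.of fun a b : Fin t => K (A a) (A b) j j).det)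

/-- `γ^max_T = max_j γ_{j,T}`. -/
def infoGainMax {𝒳 : Type*} {m : ℕ} (K : 𝒳 → 𝒳 → Matrix (Fin m) (Fin m) ℝ) (σ : ℝ) (T : ℕ) : ℝ :=
  ⨆ j : Fin m, infoGain K σ j T

/-- `Ψ_T = ∑_j √((T + 2) γ_{j,T})`. -/
def Psi {𝒳 : Type*} {m : ℕ} (K : 𝒳 → 𝒳 → Matrix (Fin m) (Fin m) ℝ) (σ : ℝ) (T : ℕ) : ℝ :=
  ∑ j : Fin m, Real.sqrt (((T : ℝ) + 2) * infoGain K σ j T)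

/-- `β_T = 2 log (m π² T² (n+1) |𝒳| / (3δ))`. -/
def beta (𝒳 : Type*) [Fintype 𝒳] (m n : ℕ) (δ : ℝ) (T : ℕ) : ℝ :=
  2 * Real.log ((m : ℝ) * Real.pi ^ 2 * (T : ℝ) ^ 2 * ((n : ℝ) + 1) * (Fintype.card 𝒳 : ℝ) /
    (3 * δ))

/-- The bound `4 𝓛 β_T^{1/2} Ψ_T / T` with `𝓛 = ∑_{i=0}^n L_i`. -/
def rateBound {𝒳 : Type*} [Fintype 𝒳] {m n : ℕ} (K : 𝒳 → 𝒳 → Matrix (Fin m) (Fin m) ℝ)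
    (σ δ : ℝ) (L : Fin (n + 1) → ℝ) (T : ℕ) : ℝ :=
  4 * (∑ i, L i) * Real.sqrt (beta 𝒳 m n δ T) * Psi K σ T / (T : ℝ)

end

end CUQB

/-! The randomness is confined to one event, whose complement has measure at most `δ`: at all times
and all points, each `f_i(x)` lies below its quantile bound `u_{i,t}(x)` and each coordinate of
`h(x)` lies within `√β_{t+1}` posterior standard deviations of its posterior mean. The rest of the
argument is pathwise.

On that event every feasible point satisfies the auxiliary constraints, so the algorithm never
stops, and optimism gives `f_0^⋆ ≤ u_{0,t}(x_{t+1})` and `0 ≤ u_{i,t}(x_{t+1})`. Regret and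
violations are therefore bounded by the gaps `u_{i,t} - f_i` at the query. By the Lipschitz
condition such a gap is at most `2 L_i √β_{t+1}` times the sum of the posterior standard deviations
of the outputs (`upper_le`, `ConfidenceHolds.upper_sub_le`). That sum does not depend on `i`, so the
query where it is smallest serves objective and constraints together
(`findsWithin_of_confidenceHolds`). Its average over `T` queries is controlled by Cauchy–Schwarz and
the information gain: conditioning on output `j` alone only enlarges the variance, and the log
determinant telescopes into conditional variances (`condVar_le_condVar_comp`, `log_det_eq_sum`).

For the probability of the event, conditional distributions are avoided. For fixed query points,
`h(x)` is the posterior mean plus a residual that is independent of the observations and has law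
`N(0, Σ_t(x))` (`indepFun_residual_obsAt`, `map_residual`). For adaptive queries, the probability
space is split by the finitely many query sequences; each piece is determined by the observations at
that fixed sequence, so the fixed-design bound applies on it (`measure_history_mem_le`). A union
bound over times, points and functions finishes. -/

open MeasureTheory ProbabilityTheory Matrix

namespace CUQB

/-! ### Conditional variances of Gaussian families: monotonicity, Schur complements, determinants.
-/

section LinearAlgebra

variable {κ ι ι' : Type*} [Fintype ι] [DecidableEq ι] [Fintype ι'] [DecidableEq ι']

/-- Variance at `k` of a centred Gaussian family with covariance `G`, given observations of its
values at the indices `q` with noise variance `c`. -/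
noncomputable def condVar (G : Matrix κ κ ℝ) (c : ℝ) (q : ι → κ) (k : κ) : ℝ :=
  G k k - (fun i => G k (q i)) ⬝ᵥ ((G.submatrix q q + c • (1 : Matrix ι ι ℝ))⁻¹ *ᵥ
    fun i => G k (q i))

omit [Fintype ι'] [DecidableEq ι'] [Fintype ι] in
lemma posDef_submatrix_add_smul_one {G : Matrix κ κ ℝ} (hG : G.PosSemidef) {c : ℝ} (hc : 0 < c)
    (q : ι → κ) : (G.submatrix q q + c • (1 : Matrix ι ι ℝ)).PosDef :=
  PosDef.posSemidef_add (hG.submatrix q) (PosDef.one.smul hc)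

-- Expand the nonnegative form of `Q` at `w - Q⁻¹ c`. The right side is the maximum of the left side
-- over `w`, so restricting `w` to fewer observations can only lower it; this is what makes
-- conditional variances monotone.
omit [Fintype ι'] [DecidableEq ι'] in
lemma two_mul_dotProduct_sub_le {Q : Matrix ι ι ℝ} (hQ : Q.PosDef) (c w : ι → ℝ) :
    2 * (w ⬝ᵥ c) - w ⬝ᵥ (Q *ᵥ w) ≤ c ⬝ᵥ (Q⁻¹ *ᵥ c) := by
  have hu : IsUnit Q.det := (Matrix.isUnit_iff_isUnit_det _).1 hQ.isUnit
  have h := hQ.posSemidef.dotProduct_mulVec_nonneg (w - Q⁻¹ *ᵥ c)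
  have hT : Qᵀ = Q := by simpa using hQ.isHermitian.eq
  have e1 : Q *ᵥ (Q⁻¹ *ᵥ c) = c := by rw [mulVec_mulVec, mul_nonsing_inv _ hu, one_mulVec]
  have e2 : (Q⁻¹ *ᵥ c) ⬝ᵥ (Q *ᵥ w) = w ⬝ᵥ c := by
    rw [dotProduct_mulVec, ← mulVec_transpose, hT, e1, dotProduct_comm]
  simp only [star_trivial, mulVec_sub, e1, sub_dotProduct, dotProduct_sub, e2] at h
  rw [dotProduct_comm (Q⁻¹ *ᵥ c) c] at h
  linarith

/-- More observations give a smaller variance. -/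
lemma condVar_le_condVar_comp {G : Matrix κ κ ℝ} (hG : G.PosSemidef) {c : ℝ} (hc : 0 < c)
    (q : ι → κ) {e : ι' → ι} (he : Function.Injective e) (k : κ) :
    condVar G c q k ≤ condVar G c (q ∘ e) k := by
  unfold condVar
  have hQ := posDef_submatrix_add_smul_one hG hc q
  have hQ' := posDef_submatrix_add_smul_one hG hc (q ∘ e)
  set Q := G.submatrix q q + c • (1 : Matrix ι ι ℝ) with hQdef
  set Q' := G.submatrix (q ∘ e) (q ∘ e) + c • (1 : Matrix ι' ι' ℝ) with hQdef'
  set b : ι → ℝ := fun i => G k (q i)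
  have hb : (fun i => G k ((q ∘ e) i)) = b ∘ e := rfl
  rw [hb]
  have hQQ : Q' = Q.submatrix e e := by
    ext i j
    simp [hQdef, hQdef', Matrix.one_apply, he.eq_iff]
  -- The optimal weights of the smaller data set, extended by zero to `w' ᵥ* P`, are tested in the
  -- variational bound for the larger one. Both terms on its left then reduce to `w' ⬝ᵥ (b ∘ e)`.
  set w' := Q'⁻¹ *ᵥ (b ∘ e) with hw'
  set P : Matrix ι' ι ℝ := Matrix.of fun a i => if e a = i then 1 else 0 with hP
  have hPv : ∀ v : ι → ℝ, P *ᵥ v = v ∘ e := by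
    intro v; ext a; simp [hP, mulVec, dotProduct]
  have hu : IsUnit Q'.det := (Matrix.isUnit_iff_isUnit_det _).1 hQ'.isUnit
  have hsub : Q' *ᵥ w' = P *ᵥ (Q *ᵥ (w' ᵥ* P)) := by
    rw [hPv]
    ext a
    have : ∀ i, (w' ᵥ* P) i = ∑ a', w' a' * (if e a' = i then 1 else 0) := fun i => rfl
    simp only [hQQ, mulVec, dotProduct, submatrix_apply, Function.comp_apply, this,
      Finset.mul_sum]
    rw [Finset.sum_comm]
    simp [mul_comm]
  have h := two_mul_dotProduct_sub_le hQ b (w' ᵥ* P)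
  have e1 : (w' ᵥ* P) ⬝ᵥ b = w' ⬝ᵥ (b ∘ e) := by rw [← dotProduct_mulVec, hPv]
  have e2 : (w' ᵥ* P) ⬝ᵥ (Q *ᵥ (w' ᵥ* P)) = w' ⬝ᵥ (b ∘ e) := by
    rw [← dotProduct_mulVec, ← hsub, hw', mulVec_mulVec, mul_nonsing_inv _ hu, one_mulVec]
  rw [e1, e2, dotProduct_comm] at h
  linarith

omit [Fintype ι'] [DecidableEq ι'] in
lemma condVar_le_self {G : Matrix κ κ ℝ} (hG : G.PosSemidef) {c : ℝ} (hc : 0 < c)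
    (q : ι → κ) (k : κ) : condVar G c q k ≤ G k k := by
  have := (posDef_submatrix_add_smul_one hG hc q).inv.posSemidef.dotProduct_mulVec_nonneg
    (fun i => G k (q i))
  simp only [star_trivial] at this
  unfold condVar
  linarith

/-- Posterior covariance matrices are positive semidefinite. -/
lemma posSemidef_condCov [Fintype κ] {G : Matrix κ κ ℝ} (hG : G.PosSemidef) {c : ℝ} (hc : 0 < c)
    (q : ι → κ) (a : ι' → κ) :
    (G.submatrix a a - G.submatrix a q * (G.submatrix q q + c • (1 : Matrix ι ι ℝ))⁻¹ *
      (G.submatrix a q)ᵀ).PosSemidef := by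
  have hD := posDef_submatrix_add_smul_one hG hc q
  let : Invertible (G.submatrix q q + c • (1 : Matrix ι ι ℝ)) := hD.isUnit.invertible
  -- The matrix is a Schur complement, so it suffices that the joint covariance of the values at `a`
  -- and the noisy observations at `q` is positive semidefinite: a submatrix of `G` plus `diag(0,
  -- c)`.
  have key := (PosDef.fromBlocks₂₂ (G.submatrix a a) (G.submatrix a q) hD).1
  rw [conjTranspose_eq_transpose_of_trivial] at key
  refine key ?_
  have h1 : (fromBlocks (0 : Matrix ι' ι' ℝ) 0 0 (c • (1 : Matrix ι ι ℝ))).PosSemidef := by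
    have : fromBlocks (0 : Matrix ι' ι' ℝ) 0 0 (c • (1 : Matrix ι ι ℝ)) =
        diagonal (Sum.elim (fun _ => (0 : ℝ)) fun _ => c) := by
      rw [smul_one_eq_diagonal, ← diagonal_zero, fromBlocks_diagonal]
    rw [this]
    refine PosSemidef.diagonal fun i => ?_
    cases i <;> simp [hc.le]
  have h2 := (hG.submatrix (Sum.elim a q)).add h1
  have hs : ∀ x y, G x y = G y x := fun x y => by simpa using hG.isHermitian.apply y x
  have h3 : fromBlocks (G.submatrix a a) (G.submatrix a q) (G.submatrix a q)ᵀ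
      (G.submatrix q q + c • (1 : Matrix ι ι ℝ)) =
      G.submatrix (Sum.elim a q) (Sum.elim a q) + fromBlocks 0 0 0 (c • 1) := by
    ext (i | i) (j | j)
    · simp
    · simp
    · simp [hs (q i) (a j)]
    · simp
  rw [h3]
  exact h2

omit [Fintype ι'] [DecidableEq ι'] in
lemma condVar_eq_condCov (G : Matrix κ κ ℝ) (c : ℝ) (q : ι → κ) (a : ι' → κ) (j : ι') :
    (G.submatrix a a - G.submatrix a q * (G.submatrix q q + c • (1 : Matrix ι ι ℝ))⁻¹ *
      (G.submatrix a q)ᵀ) j j = condVar G c q (a j) := by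
  rw [condVar, Matrix.mul_assoc]
  rfl

omit [Fintype ι'] [DecidableEq ι'] in
lemma condVar_nonneg [Fintype κ] {G : Matrix κ κ ℝ} (hG : G.PosSemidef) {c : ℝ} (hc : 0 < c)
    (q : ι → κ) (k : κ) : 0 ≤ condVar G c q k := by
  rw [← condVar_eq_condCov G c q (fun _ : Unit => k) ()]
  exact (posSemidef_condCov hG hc q _).diag_nonneg

/-- Adding a noisy observation multiplies the determinant by the conditional variance of the
new observation. -/
lemma det_one_add_smul_snoc {G : Matrix κ κ ℝ} (hG : G.PosSemidef) {c : ℝ} (hc : 0 < c) {n : ℕ}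
    (q : Fin n → κ) (k : κ) :
    (1 + c⁻¹ • G.submatrix (Fin.snoc q k : Fin (n + 1) → κ) (Fin.snoc q k)).det =
      (1 + c⁻¹ • G.submatrix q q).det * (1 + c⁻¹ * condVar G c q k) := by
  have hc' : c ≠ 0 := hc.ne'
  have hs : ∀ x y, G x y = G y x := fun x y => by simpa using hG.isHermitian.apply y x
  have hD := posDef_submatrix_add_smul_one hG hc q
  have hA : (1 : Matrix (Fin n) (Fin n) ℝ) + c⁻¹ • G.submatrix q q =
      c⁻¹ • (G.submatrix q q + c • (1 : Matrix (Fin n) (Fin n) ℝ)) := by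
    rw [smul_add, smul_smul, inv_mul_cancel₀ hc', one_smul, add_comm]
  have hu : IsUnit (G.submatrix q q + c • (1 : Matrix (Fin n) (Fin n) ℝ)).det :=
    (Matrix.isUnit_iff_isUnit_det _).1 hD.isUnit
  have hAd : ((1 : Matrix (Fin n) (Fin n) ℝ) + c⁻¹ • G.submatrix q q).PosDef := by
    rw [hA]; exact hD.smul (inv_pos.2 hc)
  let : Invertible ((1 : Matrix (Fin n) (Fin n) ℝ) + c⁻¹ • G.submatrix q q) :=
    hAd.isUnit.invertible
  have hAinv : ((1 : Matrix (Fin n) (Fin n) ℝ) + c⁻¹ • G.submatrix q q)⁻¹ =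
      c • (G.submatrix q q + c • (1 : Matrix (Fin n) (Fin n) ℝ))⁻¹ := by
    refine Matrix.inv_eq_right_inv ?_
    rw [hA, Matrix.smul_mul, Matrix.mul_smul, smul_smul, inv_mul_cancel₀ hc', one_smul,
      mul_nonsing_inv _ hu]
  -- Splitting off the last index gives a block matrix whose one-by-one Schur complement is the new
  -- factor.
  rw [← det_submatrix_equiv_self finSumFinEquiv]
  have hblock : (1 + c⁻¹ • G.submatrix (Fin.snoc q k : Fin (n + 1) → κ) (Fin.snoc q k)).submatrix
      (finSumFinEquiv (m := n) (n := 1)) finSumFinEquiv =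
      fromBlocks (1 + c⁻¹ • G.submatrix q q) (of fun i _ => c⁻¹ * G k (q i))
        (of fun _ i => c⁻¹ * G k (q i)) (of fun _ _ => 1 + c⁻¹ * G k k) := by
    have e1 : ∀ i : Fin n, (Fin.snoc q k : Fin (n + 1) → κ) (Fin.castAdd 1 i) = q i := fun i =>
      Fin.snoc_castSucc (α := fun _ => κ) k q i
    have e2 : ∀ i : Fin 1, (Fin.snoc q k : Fin (n + 1) → κ) (Fin.natAdd n i) = k := fun i => by
      have : Fin.natAdd n i = Fin.last n := by ext; simp
      rw [this]
      exact Fin.snoc_last (α := fun _ => κ) k q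
    have e3 : ∀ i j : Fin 1, i = j := fun i j => Subsingleton.elim i j
    have e4 : ∀ (i : Fin n) (j : Fin 1), Fin.castAdd 1 i ≠ Fin.natAdd n j := fun i j h => by
      have := congrArg Fin.val h
      simp at this
      omega
    ext (i | i) (j | j)
    · simp [e1, Matrix.one_apply]
    · simp [e1, e2, e4, hs (q _) k]
    · simp [e1, e2, (e4 _ _).symm]
    · simp [e2, e3 i j]
  rw [hblock, det_fromBlocks₁₁, det_fin_one, invOf_eq_nonsing_inv, hAinv]
  congr 1
  have : (of (fun (_ : Fin 1) (i : Fin n) => c⁻¹ * G k (q i)) *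
      c • (G.submatrix q q + c • (1 : Matrix (Fin n) (Fin n) ℝ))⁻¹ *
      of fun (i : Fin n) (_ : Fin 1) => c⁻¹ * G k (q i)) 0 0 =
      c⁻¹ * ((fun i => G k (q i)) ⬝ᵥ ((G.submatrix q q + c • (1 : Matrix (Fin n) (Fin n) ℝ))⁻¹ *ᵥ
        fun i => G k (q i))) := by
    rw [Matrix.mul_assoc, Matrix.smul_mul]
    simp only [Matrix.mul_apply, dotProduct, mulVec, of_apply, Matrix.smul_apply, smul_eq_mul,
      Finset.mul_sum]
    refine Finset.sum_congr rfl fun i _ => Finset.sum_congr rfl fun j _ => ?_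
    field_simp
  rw [Matrix.sub_apply, this, condVar, of_apply]
  ring

end LinearAlgebra

/-! ### Gaussian tail bounds. -/

section GaussianTail

/-- Two-sided tail of the standard Gaussian distribution. -/
lemma gaussianReal_zero_one_abs_gt_le {c : ℝ} (hc : 0 ≤ c) :
    gaussianReal 0 1 {x | c < |x|} ≤ ENNReal.ofReal (Real.exp (-c ^ 2 / 2)) := by
  have hsplit : {x : ℝ | c < |x|} ⊆ Set.Ioi c ∪ Set.Iio (-c) := by
    intro x hx
    simp only [Set.mem_ofPred_eq] at hx
    rcases lt_abs.1 hx with h | h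
    · exact Or.inl h
    · exact Or.inr (by simp only [Set.mem_Iio]; linarith)
  have hpdf : ∀ (d x : ℝ), |d| = c → 0 ≤ -d * x →
      gaussianPDF d 1 x ≤ ENNReal.ofReal (Real.exp (-c ^ 2 / 2)) * gaussianPDF 0 1 x := by
    intro d x hd hx
    rw [gaussianPDF, gaussianPDF, ← ENNReal.ofReal_mul (Real.exp_pos _).le]
    refine ENNReal.ofReal_le_ofReal ?_
    rw [gaussianPDFReal, gaussianPDFReal, mul_left_comm, ← Real.exp_add]
    have hd2 : d ^ 2 = c ^ 2 := by rw [← hd, sq_abs]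
    refine mul_le_mul_of_nonneg_left (Real.exp_le_exp.2 ?_) (by positivity)
    simp only [NNReal.coe_one, mul_one, sub_zero]
    nlinarith
  have h1 : gaussianReal 0 1 (Set.Ioi c) ≤
      ENNReal.ofReal (Real.exp (-c ^ 2 / 2)) * gaussianReal 0 1 (Set.Ioi 0) := by
    have : gaussianReal 0 1 (Set.Ioi c) = gaussianReal (-c) 1 (Set.Ioi 0) := by
      rw [← zero_sub, ← gaussianReal_map_sub_const c, Measure.map_apply (by fun_prop)
        measurableSet_Ioi]
      congr 1; ext x; simp
    rw [this, gaussianReal_apply _ one_ne_zero, gaussianReal_apply _ one_ne_zero,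
      ← lintegral_const_mul _ (measurable_gaussianPDF _ _)]
    refine setLIntegral_mono ((measurable_gaussianPDF _ _).const_mul _) fun x hx => ?_
    refine hpdf _ _ (by rw [abs_neg, abs_of_nonneg hc]) ?_
    rw [neg_neg]; exact mul_nonneg hc (le_of_lt hx)
  have h2 : gaussianReal 0 1 (Set.Iio (-c)) ≤
      ENNReal.ofReal (Real.exp (-c ^ 2 / 2)) * gaussianReal 0 1 (Set.Iio 0) := by
    have : gaussianReal 0 1 (Set.Iio (-c)) = gaussianReal c 1 (Set.Iio 0) := by
      rw [← zero_add c, ← gaussianReal_map_add_const c, Measure.map_apply (by fun_prop)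
        measurableSet_Iio]
      congr 1; ext x; simp [lt_neg_iff_add_neg]
    rw [this, gaussianReal_apply _ one_ne_zero, gaussianReal_apply _ one_ne_zero,
      ← lintegral_const_mul _ (measurable_gaussianPDF _ _)]
    refine setLIntegral_mono ((measurable_gaussianPDF _ _).const_mul _) fun x hx => ?_
    refine hpdf _ _ (abs_of_nonneg hc) ?_
    have : x < 0 := hx
    nlinarith
  calc gaussianReal 0 1 {x | c < |x|}
      ≤ gaussianReal 0 1 (Set.Ioi c) + gaussianReal 0 1 (Set.Iio (-c)) :=
        (measure_mono hsplit).trans (measure_union_le _ _)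
    _ ≤ ENNReal.ofReal (Real.exp (-c ^ 2 / 2)) * gaussianReal 0 1 (Set.Ioi 0) +
        ENNReal.ofReal (Real.exp (-c ^ 2 / 2)) * gaussianReal 0 1 (Set.Iio 0) := add_le_add h1 h2
    _ = ENNReal.ofReal (Real.exp (-c ^ 2 / 2)) *
        gaussianReal 0 1 (Set.Ioi 0 ∪ Set.Iio 0) := by
        rw [← mul_add, measure_union _ measurableSet_Iio]
        exact Set.disjoint_left.2 fun x hx hx' => lt_asymm (Set.mem_Ioi.1 hx) (Set.mem_Iio.1 hx')
    _ ≤ ENNReal.ofReal (Real.exp (-c ^ 2 / 2)) := by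
        conv_rhs => rw [← mul_one (ENNReal.ofReal _)]
        gcongr
        exact prob_le_one

/-- Two-sided tail of a centred Gaussian distribution. -/
lemma gaussianReal_abs_gt_le {c : ℝ} (hc : 0 ≤ c) (v : NNReal) :
    gaussianReal 0 v {x | c * Real.sqrt v < |x|} ≤ ENNReal.ofReal (Real.exp (-c ^ 2 / 2)) := by
  rcases eq_or_ne v 0 with rfl | hv
  · simp
  · have hv' : 0 < Real.sqrt v := Real.sqrt_pos.2 (by exact_mod_cast pos_iff_ne_zero.2 hv)
    have hmap : gaussianReal 0 v = (gaussianReal 0 1).map (Real.sqrt v * ·) := by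
      rw [gaussianReal_map_const_mul]
      congr 1
      · simp
      · ext; simp
    rw [hmap, Measure.map_apply (by fun_prop) (measurableSet_lt (by fun_prop) (by fun_prop))]
    refine le_trans (measure_mono ?_) (gaussianReal_zero_one_abs_gt_le hc)
    intro x hx
    simp only [Set.mem_preimage, Set.mem_ofPred_eq, abs_mul, abs_of_pos hv'] at hx
    rw [mul_comm] at hx
    exact lt_of_mul_lt_mul_left hx hv'.le

end GaussianTail

/-! ### The Gaussian process posterior for prescribed query points. -/

section Posterior

/-- A jointly Gaussian centred vector with covariance matrix `S` has law `N(0, S)`. -/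
lemma map_toLp_eq_multivariateGaussian {Ω ι : Type*} [Fintype ι] [DecidableEq ι]
    [MeasurableSpace Ω] {μ : Measure Ω} {X : Ω → ι → ℝ} (hX : HasGaussianLaw X μ)
    {S : Matrix ι ι ℝ} (hS : S.PosSemidef) (hmean : ∀ i, ∫ ω, X ω i ∂μ = 0)
    (hcov : ∀ i j, cov[fun ω => X ω i, fun ω => X ω j; μ] = S i j) :
    μ.map (fun ω => WithLp.toLp 2 (X ω)) = multivariateGaussian 0 S := by
  have hX' : HasGaussianLaw (fun ω => WithLp.toLp 2 (X ω)) μ :=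
    hX.map_fun (EuclideanSpace.equiv ι ℝ).symm.toContinuousLinearMap
  have := hX'.isGaussian_map
  have := hX'.isProbabilityMeasure
  have hae := hX'.aemeasurable
  refine IsGaussian.ext ?_ ?_
  · simp only [id_eq, integral_id_multivariateGaussian]
    rw [integral_map hae (by fun_prop)]
    ext i
    have h := (EuclideanSpace.proj (𝕜 := ℝ) i).integral_comp_comm hX'.integrable
    simp only [EuclideanSpace.coe_proj] at h
    rw [← h, hmean]
    rfl
  · rw [← ContinuousLinearMap.toBilinForm_inj]
    refine LinearMap.BilinForm.ext_basis (EuclideanSpace.basisFun ι ℝ).toBasis fun i j => ?_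
    rw [ContinuousLinearMap.toBilinForm_apply, ContinuousLinearMap.toBilinForm_apply,
      covarianceBilin_apply_eq_cov IsGaussian.memLp_two_id,
      covariance_map (Measurable.aestronglyMeasurable (by fun_prop))
        (Measurable.aestronglyMeasurable (by fun_prop)) hae,
      covarianceBilin_multivariateGaussian hS]
    have h : ∀ i : ι, (fun u => inner ℝ ((EuclideanSpace.basisFun ι ℝ).toBasis i) u) ∘
        (fun ω => WithLp.toLp 2 (X ω)) = fun ω => X ω i := by
      intro i; ext; simp [PiLp.inner_apply]
    rw [h, h, hcov]
    simp

/-- Values of independent variables: sections of measure at most `p` give a conditional bound. -/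
lemma measure_indepFun_inter_le {Ω α β : Type*} [MeasurableSpace Ω] [MeasurableSpace α]
    [MeasurableSpace β] {μ : Measure Ω} [IsProbabilityMeasure μ] {X : Ω → α} {Y : Ω → β}
    (hX : Measurable X) (hY : Measurable Y) (hXY : IndepFun X Y μ) {B : Set (α × β)}
    (hB : MeasurableSet B) {E : Set β} (hE : MeasurableSet E) {p : ENNReal}
    (hp : ∀ y, μ.map X {x | (x, y) ∈ B} ≤ p) :
    μ {ω | Y ω ∈ E ∧ (X ω, Y ω) ∈ B} ≤ p * μ (Y ⁻¹' E) := by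
  have hBE : MeasurableSet (B ∩ Prod.snd ⁻¹' E) := hB.inter (measurable_snd hE)
  have e1 : {ω | Y ω ∈ E ∧ (X ω, Y ω) ∈ B} = (fun ω => (X ω, Y ω)) ⁻¹' (B ∩ Prod.snd ⁻¹' E) := by
    ext ω
    simp [and_comm]
  have : IsProbabilityMeasure (μ.map X) := Measure.isProbabilityMeasure_map hX.aemeasurable
  have : IsProbabilityMeasure (μ.map Y) := Measure.isProbabilityMeasure_map hY.aemeasurable
  rw [e1, ← Measure.map_apply (hX.prodMk hY) hBE,
    (indepFun_iff_map_prod_eq_prod_map_map hX.aemeasurable hY.aemeasurable).1 hXY,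
    Measure.prod_apply_symm hBE, ← Measure.map_apply hY hE, ← lintegral_indicator_const hE]
  refine lintegral_mono fun y => ?_
  by_cases hy : y ∈ E
  · rw [Set.indicator_of_mem hy]
    exact (measure_mono fun x hx => hx.1).trans (hp y)
  · rw [Set.indicator_of_notMem hy]
    have : (fun x => (x, y)) ⁻¹' (B ∩ Prod.snd ⁻¹' E) = ∅ := by
      ext x
      simp [hy]
    simp [this]

variable {𝒳 : Type*} {m : ℕ}

/-- The observations made at prescribed query points `A`. -/
def obsAt {t : ℕ} (A : Fin t → 𝒳) (h : 𝒳 → Fin m → ℝ) (e : ℕ → Fin m → ℝ) : Fin t × Fin m → ℝ :=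
  fun p => h (A p.1) p.2 + e p.1 p.2

/-- The data set with query points `A` and observations `y`. -/
def dataOf {t : ℕ} (A : Fin t → 𝒳) (y : Fin t × Fin m → ℝ) : Data 𝒳 m t :=
  fun a => (A a, fun j => y (a, j))

variable [Fintype 𝒳] [DecidableEq 𝒳]
  {Ω : Type*} [MeasurableSpace Ω] {μ : Measure Ω}
  {K : 𝒳 → 𝒳 → Matrix (Fin m) (Fin m) ℝ} {σ : ℝ} {h : Ω → 𝒳 → Fin m → ℝ}
  {ε : ℕ → Ω → Fin m → ℝ}

lemma IsGPModel.hasGaussianLaw_h (hM : IsGPModel μ K σ h ε) :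
    HasGaussianLaw (fun ω (p : 𝒳 × Fin m) => h ω p.1 p.2) μ :=
  hM.law_h.hasGaussianLaw.map_fun (EuclideanSpace.equiv (𝒳 × Fin m) ℝ).toContinuousLinearMap

lemma IsGPModel.hasGaussianLaw_noise (hM : IsGPModel μ K σ h ε) (t : ℕ) :
    HasGaussianLaw (fun ω (p : Fin t × Fin m) => ε p.1 ω p.2) μ := by
  have hinj : Function.Injective (fun p : Fin t × Fin m => ((p.1 : ℕ), p.2)) := by
    rintro ⟨a, j⟩ ⟨b, k⟩ hab
    simp only [Prod.mk.injEq, Fin.val_inj] at hab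
    exact Prod.ext hab.1 hab.2
  exact (hM.indep_noise.precomp hinj).hasGaussianLaw
    fun p => (hM.law_noise p.1 p.2).hasGaussianLaw

lemma IsGPModel.hasGaussianLaw_prod (hM : IsGPModel μ K σ h ε) (t : ℕ) :
    HasGaussianLaw (fun ω => ((fun p : 𝒳 × Fin m => h ω p.1 p.2),
      fun p : Fin t × Fin m => ε p.1 ω p.2)) μ := by
  refine IndepFun.hasGaussianLaw hM.hasGaussianLaw_h (hM.hasGaussianLaw_noise t) ?_
  exact hM.indep_h_noise.comp
    (φ := fun (f : 𝒳 → Fin m → ℝ) (p : 𝒳 × Fin m) => f p.1 p.2)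
    (ψ := fun (e : ℕ → Fin m → ℝ) (p : Fin t × Fin m) => e p.1 p.2)
    (by fun_prop) (by fun_prop)

lemma IsGPModel.memLp_h (hM : IsGPModel μ K σ h ε) (x : 𝒳) (j : Fin m) :
    MemLp (fun ω => h ω x j) 2 μ :=
  (hM.hasGaussianLaw_h.eval (x, j)).memLp_two

lemma IsGPModel.memLp_noise (hM : IsGPModel μ K σ h ε) (t : ℕ) (j : Fin m) :
    MemLp (fun ω => ε t ω j) 2 μ :=
  (hM.law_noise t j).hasGaussianLaw.memLp_two

lemma IsGPModel.covariance_h_h (hM : IsGPModel μ K σ h ε)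
    (hK : (kernelMatrix K id).PosSemidef) (x x' : 𝒳) (i j : Fin m) :
    cov[fun ω => h ω x i, fun ω => h ω x' j; μ] = K x x' i j := by
  have := hM.law_h.covariance_fun_comp (f := fun z => z (x, i)) (g := fun z => z (x', j))
    (by fun_prop) (by fun_prop)
  rw [covariance_eval_multivariateGaussian hK] at this
  exact this

lemma IsGPModel.integral_h (hM : IsGPModel μ K σ h ε) (x : 𝒳) (j : Fin m) :
    ∫ ω, h ω x j ∂μ = 0 := by
  have := hM.law_h.integral_comp (f := fun z => z (x, j)) (by fun_prop)
  refine this.trans ?_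
  have h2 := (EuclideanSpace.proj (𝕜 := ℝ) (x, j)).integral_comp_comm
    (IsGaussian.integrable_id (μ := multivariateGaussian 0 (kernelMatrix K id)))
  simp only [EuclideanSpace.coe_proj, id_eq, integral_id_multivariateGaussian] at h2
  exact h2

lemma IsGPModel.integral_noise (hM : IsGPModel μ K σ h ε) (t : ℕ) (j : Fin m) :
    ∫ ω, ε t ω j ∂μ = 0 := by
  rw [(hM.law_noise t j).integral_eq]
  simp

lemma IsGPModel.covariance_h_noise (hM : IsGPModel μ K σ h ε) (x : 𝒳) (i : Fin m) (t : ℕ)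
    (j : Fin m) : cov[fun ω => h ω x i, fun ω => ε t ω j; μ] = 0 := by
  refine IndepFun.covariance_eq_zero ?_ (hM.memLp_h x i) (hM.memLp_noise t j)
  exact hM.indep_h_noise.comp (φ := fun (f : 𝒳 → Fin m → ℝ) => f x i)
    (ψ := fun (e : ℕ → Fin m → ℝ) => e t j) (by fun_prop) (by fun_prop)

lemma IsGPModel.covariance_noise_noise (hM : IsGPModel μ K σ h ε) (p q : ℕ × Fin m) :
    cov[fun ω => ε p.1 ω p.2, fun ω => ε q.1 ω q.2; μ] = if p = q then σ ^ 2 else 0 := by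
  split_ifs with hpq
  · subst hpq
    rw [covariance_self (hM.memLp_noise _ _).aemeasurable, (hM.law_noise p.1 p.2).variance_eq,
      variance_id_gaussianReal]
    simp [sq_nonneg]
  · exact (hM.indep_noise.indepFun hpq).covariance_eq_zero (hM.memLp_noise _ _)
      (hM.memLp_noise _ _)

section Residual

variable {t : ℕ} (A : Fin t → 𝒳) (x : 𝒳)

/-- Kriging weights: the posterior mean at `x` is this matrix times the observations. -/
noncomputable def weights (K : 𝒳 → 𝒳 → Matrix (Fin m) (Fin m) ℝ) (σ : ℝ) :
    Matrix (Fin m) (Fin t × Fin m) ℝ :=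
  crossCov K A x * (kernelMatrix K A + σ ^ 2 • (1 : Matrix (Fin t × Fin m) (Fin t × Fin m) ℝ))⁻¹

/-- Prediction error of the posterior mean of `h(x)` given observations at `A`. -/
noncomputable def residual (K : 𝒳 → 𝒳 → Matrix (Fin m) (Fin m) ℝ) (σ : ℝ)
    (h : 𝒳 → Fin m → ℝ) (e : ℕ → Fin m → ℝ) : Fin m → ℝ :=
  fun j => h x j - (weights A x K σ *ᵥ obsAt A h e) j

omit [Fintype 𝒳] [DecidableEq 𝒳] in
lemma postMean_dataOf (y : Fin t × Fin m → ℝ) :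
    postMean K σ (dataOf A y) x = weights A x K σ *ᵥ y := rfl

omit [Fintype 𝒳] [DecidableEq 𝒳] in
lemma postCov_dataOf (y : Fin t × Fin m → ℝ) :
    postCov K σ (dataOf A y) x = K x x - weights A x K σ * (crossCov K A x)ᵀ := rfl

omit [Fintype 𝒳] [DecidableEq 𝒳] in
lemma measurable_obsAt (hh : Measurable h) (hε : ∀ t, Measurable (ε t)) :
    Measurable fun ω => obsAt A (h ω) (fun s => ε s ω) := by
  unfold obsAt
  fun_prop

omit [Fintype 𝒳] [DecidableEq 𝒳] in
lemma measurable_residual (hh : Measurable h) (hε : ∀ t, Measurable (ε t)) :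
    Measurable fun ω => residual A x K σ (h ω) (fun s => ε s ω) := by
  have := measurable_obsAt A hh hε
  unfold residual mulVec dotProduct
  fun_prop

/-- Both components are linear images of the jointly Gaussian pair formed by the function values and
the noise. -/
lemma IsGPModel.hasGaussianLaw_residual_obsAt (hM : IsGPModel μ K σ h ε) :
    HasGaussianLaw (fun ω => (residual A x K σ (h ω) (fun s => ε s ω),
      obsAt A (h ω) (fun s => ε s ω))) μ := by
  let LY : ((𝒳 × Fin m → ℝ) × (Fin t × Fin m → ℝ)) →ₗ[ℝ] (Fin t × Fin m → ℝ) :=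
    { toFun := fun z p => z.1 (A p.1, p.2) + z.2 p
      map_add' := fun z w => by ext p; simp only [Prod.fst_add, Prod.snd_add, Pi.add_apply]; ring
      map_smul' := fun c z => by ext p; simp [mul_add] }
  let LH : ((𝒳 × Fin m → ℝ) × (Fin t × Fin m → ℝ)) →ₗ[ℝ] (Fin m → ℝ) :=
    { toFun := fun z j => z.1 (x, j)
      map_add' := fun z w => rfl
      map_smul' := fun c z => rfl }
  exact (hM.hasGaussianLaw_prod t).map_fun
    (((LH - (Matrix.mulVecLin (weights A x K σ)).comp LY).prod LY).toContinuousLinearMap)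

lemma IsGPModel.memLp_obsAt (hM : IsGPModel μ K σ h ε) (b : Fin t × Fin m) :
    MemLp (fun ω => obsAt A (h ω) (fun s => ε s ω) b) 2 μ :=
  (hM.memLp_h _ _).add (hM.memLp_noise _ _)

variable [IsProbabilityMeasure μ]

lemma IsGPModel.covariance_h_obsAt (hM : IsGPModel μ K σ h ε)
    (hK : (kernelMatrix K id).PosSemidef) (x : 𝒳) (i : Fin m) (b : Fin t × Fin m) :
    cov[fun ω => h ω x i, fun ω => obsAt A (h ω) (fun s => ε s ω) b; μ] = K x (A b.1) i b.2 := by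
  have := covariance_add_right (hM.memLp_h x i) (hM.memLp_h (A b.1) b.2)
    (hM.memLp_noise b.1 b.2)
  rw [hM.covariance_h_h hK, hM.covariance_h_noise, add_zero] at this
  exact this

lemma IsGPModel.covariance_obsAt_obsAt (hM : IsGPModel μ K σ h ε)
    (hK : (kernelMatrix K id).PosSemidef) (a b : Fin t × Fin m) :
    cov[fun ω => obsAt A (h ω) (fun s => ε s ω) a,
      fun ω => obsAt A (h ω) (fun s => ε s ω) b; μ] =
    (kernelMatrix K A + σ ^ 2 • (1 : Matrix (Fin t × Fin m) (Fin t × Fin m) ℝ)) a b := by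
  have h1 := covariance_add_left (hM.memLp_h (A a.1) a.2) (hM.memLp_noise a.1 a.2)
    (hM.memLp_obsAt A b)
  have h2 := covariance_add_right (hM.memLp_noise a.1 a.2) (hM.memLp_h (A b.1) b.2)
    (hM.memLp_noise b.1 b.2)
  rw [covariance_comm (fun ω => ε a.1 ω a.2) (fun ω => h ω (A b.1) b.2),
    hM.covariance_h_noise, zero_add, hM.covariance_noise_noise (a.1, a.2) (b.1, b.2)] at h2
  rw [hM.covariance_h_obsAt A hK] at h1
  refine h1.trans ?_
  rw [Matrix.add_apply, Matrix.smul_apply, Matrix.one_apply]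
  congr 1
  refine h2.trans ?_
  have : (((a.1 : ℕ), a.2) = ((b.1 : ℕ), b.2)) ↔ a = b := by
    rw [Prod.ext_iff, Prod.ext_iff]
    simp [Fin.val_inj]
  simp [this]

lemma IsGPModel.covariance_weights_obsAt (hM : IsGPModel μ K σ h ε) (W : Matrix (Fin m)
    (Fin t × Fin m) ℝ) (i : Fin m) {Z : Ω → ℝ} (hZ : MemLp Z 2 μ) :
    cov[fun ω => (W *ᵥ obsAt A (h ω) (fun s => ε s ω)) i, Z; μ] =
      ∑ a, W i a * cov[fun ω => obsAt A (h ω) (fun s => ε s ω) a, Z; μ] := by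
  unfold mulVec dotProduct
  rw [covariance_fun_sum_left (fun a => (hM.memLp_obsAt A a).const_mul _) hZ]
  simp_rw [covariance_const_mul_left]

omit [IsProbabilityMeasure μ] in
lemma IsGPModel.memLp_weights_obsAt (hM : IsGPModel μ K σ h ε) (W : Matrix (Fin m)
    (Fin t × Fin m) ℝ) (i : Fin m) :
    MemLp (fun ω => (W *ᵥ obsAt A (h ω) (fun s => ε s ω)) i) 2 μ := by
  unfold mulVec dotProduct
  exact memLp_finsetSum _ fun a _ => (hM.memLp_obsAt A a).const_mul _

/-- The weights solve the normal equations `weights * (K_A + σ² I) = crossCov`, which say precisely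
that the error is orthogonal to the data. -/
lemma IsGPModel.covariance_residual_obsAt (hM : IsGPModel μ K σ h ε)
    (hK : (kernelMatrix K id).PosSemidef) (hσ : 0 < σ) (i : Fin m) (b : Fin t × Fin m) :
    cov[fun ω => residual A x K σ (h ω) (fun s => ε s ω) i,
      fun ω => obsAt A (h ω) (fun s => ε s ω) b; μ] = 0 := by
  have h1 := covariance_fun_sub_left (hM.memLp_h x i)
    (hM.memLp_weights_obsAt A (weights A x K σ) i) (hM.memLp_obsAt A b)
  refine h1.trans ?_
  rw [hM.covariance_h_obsAt A hK, hM.covariance_weights_obsAt A _ _ (hM.memLp_obsAt A b)]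
  simp_rw [hM.covariance_obsAt_obsAt A hK]
  have hpd : (kernelMatrix K A +
      σ ^ 2 • (1 : Matrix (Fin t × Fin m) (Fin t × Fin m) ℝ)).PosDef :=
    posDef_submatrix_add_smul_one hK (pow_pos hσ 2) (fun p : Fin t × Fin m => (A p.1, p.2))
  have hu := (Matrix.isUnit_iff_isUnit_det _).1 hpd.isUnit
  have : weights A x K σ *
      (kernelMatrix K A + σ ^ 2 • (1 : Matrix (Fin t × Fin m) (Fin t × Fin m) ℝ)) =
      crossCov K A x := by
    rw [weights, Matrix.mul_assoc, nonsing_inv_mul _ hu, Matrix.mul_one]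
  have h2 := congrFun (congrFun this i) b
  rw [Matrix.mul_apply] at h2
  rw [h2]
  simp [crossCov]

/-- By orthogonality to the data, one of the two residuals may be replaced by `h(x)` itself. -/
lemma IsGPModel.covariance_residual_residual (hM : IsGPModel μ K σ h ε)
    (hK : (kernelMatrix K id).PosSemidef) (hσ : 0 < σ) (i j : Fin m) :
    cov[fun ω => residual A x K σ (h ω) (fun s => ε s ω) i,
      fun ω => residual A x K σ (h ω) (fun s => ε s ω) j; μ] =
    (K x x - weights A x K σ * (crossCov K A x)ᵀ) i j := by
  have hR : ∀ k, MemLp (fun ω => residual A x K σ (h ω) (fun s => ε s ω) k) 2 μ := fun k =>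
    (hM.memLp_h x k).sub (hM.memLp_weights_obsAt A (weights A x K σ) k)
  have h1 := covariance_fun_sub_right (hR i) (hM.memLp_h x j)
    (hM.memLp_weights_obsAt A (weights A x K σ) j)
  refine h1.trans ?_
  rw [covariance_comm _ (fun ω => (weights A x K σ *ᵥ obsAt A (h ω) (fun s => ε s ω)) j),
    hM.covariance_weights_obsAt A _ _ (hR i)]
  have h2 : ∀ b, cov[fun ω => obsAt A (h ω) (fun s => ε s ω) b,
      fun ω => residual A x K σ (h ω) (fun s => ε s ω) i; μ] = 0 := fun b => by
    rw [covariance_comm, hM.covariance_residual_obsAt A x hK hσ]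
  simp_rw [h2, mul_zero, Finset.sum_const_zero, sub_zero]
  have h3 := covariance_fun_sub_left (hM.memLp_h x i)
    (hM.memLp_weights_obsAt A (weights A x K σ) i) (hM.memLp_h x j)
  refine h3.trans ?_
  rw [hM.covariance_h_h hK, hM.covariance_weights_obsAt A _ _ (hM.memLp_h x j),
    Matrix.sub_apply, Matrix.mul_apply]
  congr 1
  refine Finset.sum_congr rfl fun a _ => ?_
  rw [covariance_comm, hM.covariance_h_obsAt A hK]
  rfl

lemma IsGPModel.integral_residual (hM : IsGPModel μ K σ h ε) (i : Fin m) :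
    ∫ ω, residual A x K σ (h ω) (fun s => ε s ω) i ∂μ = 0 := by
  have hY : ∀ a, ∫ ω, obsAt A (h ω) (fun s => ε s ω) a ∂μ = 0 := fun a => by
    unfold obsAt
    rw [integral_add ((hM.memLp_h _ _).integrable (by norm_num))
      ((hM.memLp_noise _ _).integrable (by norm_num)), hM.integral_h, hM.integral_noise, add_zero]
  unfold residual
  rw [integral_sub ((hM.memLp_h _ _).integrable (by norm_num))
    ((hM.memLp_weights_obsAt A _ _).integrable (by norm_num)), hM.integral_h]
  unfold mulVec dotProduct
  rw [integral_finsetSum _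
    fun a _ => ((hM.memLp_obsAt A a).const_mul _).integrable (by norm_num)]
  simp_rw [integral_const_mul, hY]
  simp

/-- Uncorrelated and jointly Gaussian, hence independent. This stands in for disintegration:
freezing the data leaves the law of the residual unchanged. -/
lemma IsGPModel.indepFun_residual_obsAt (hM : IsGPModel μ K σ h ε)
    (hK : (kernelMatrix K id).PosSemidef) (hσ : 0 < σ) :
    IndepFun (fun ω => residual A x K σ (h ω) (fun s => ε s ω))
      (fun ω => obsAt A (h ω) (fun s => ε s ω)) μ :=
  HasGaussianLaw.indepFun_of_covariance_eval
    (X := fun i ω => residual A x K σ (h ω) (fun s => ε s ω) i)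
    (Y := fun b ω => obsAt A (h ω) (fun s => ε s ω) b)
    (hM.hasGaussianLaw_residual_obsAt A x) (hM.covariance_residual_obsAt A x hK hσ)

omit [DecidableEq 𝒳] in
lemma posSemidef_postCov (hK : (kernelMatrix K id).PosSemidef) (hσ : 0 < σ) (D : Data 𝒳 m t) :
    (postCov K σ D x).PosSemidef :=
  posSemidef_condCov hK (pow_pos hσ 2) (fun p : Fin t × Fin m => ((D p.1).1, p.2))
    (fun j : Fin m => (x, j))

/-- The posterior covariance depends on the query points only, so `y` is an arbitrary placeholder.
-/
lemma IsGPModel.map_residual (hM : IsGPModel μ K σ h ε)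
    (hK : (kernelMatrix K id).PosSemidef) (hσ : 0 < σ) (y : Fin t × Fin m → ℝ) :
    μ.map (fun ω => WithLp.toLp 2 (residual A x K σ (h ω) (fun s => ε s ω))) =
      multivariateGaussian 0 (postCov K σ (dataOf A y) x) :=
  map_toLp_eq_multivariateGaussian (hM.hasGaussianLaw_residual_obsAt A x).fst
    (posSemidef_postCov x hK hσ _) (hM.integral_residual A x)
    (hM.covariance_residual_residual A x hK hσ)

lemma multivariateGaussian_eq_map_const_add {ι : Type*} [Fintype ι] [DecidableEq ι]
    (v : EuclideanSpace ℝ ι) (S : Matrix ι ι ℝ) :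
    multivariateGaussian v S = (multivariateGaussian 0 S).map (v + ·) := by
  unfold multivariateGaussian
  rw [Measure.map_map (by fun_prop) (by fun_prop)]
  congr 1
  ext z
  simp

/-- Conditional probability bound for prescribed query points: if the posterior probability of the
set `B D` is at most `p` for all data, then so is the probability that `h(x)` lies in it. -/
lemma IsGPModel.measure_obsAt_mem_le (hM : IsGPModel μ K σ h ε)
    (hK : (kernelMatrix K id).PosSemidef) (hσ : 0 < σ)
    {B : Data 𝒳 m t → Set (Fin m → ℝ)}
    (hB : MeasurableSet {z : (Fin m → ℝ) × (Fin t × Fin m → ℝ) | z.1 ∈ B (dataOf A z.2)})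
    {p : ENNReal} (hp : ∀ D, multivariateGaussian (WithLp.toLp 2 (postMean K σ D x))
      (postCov K σ D x) {z | WithLp.ofLp z ∈ B D} ≤ p)
    {E : Set (Fin t × Fin m → ℝ)} (hE : MeasurableSet E) :
    μ {ω | obsAt A (h ω) (fun s => ε s ω) ∈ E ∧
      h ω x ∈ B (dataOf A (obsAt A (h ω) (fun s => ε s ω)))} ≤
      p * μ ((fun ω => obsAt A (h ω) (fun s => ε s ω)) ⁻¹' E) := by
  have hR := measurable_residual (K := K) (σ := σ) A x hM.measurable_h hM.measurable_noise
  have hY := measurable_obsAt A hM.measurable_h hM.measurable_noise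
  -- `F` recovers the pair of `h(x)` and the observations from the independent pair of residual and
  -- observations.
  let F : (Fin m → ℝ) × (Fin t × Fin m → ℝ) → (Fin m → ℝ) × (Fin t × Fin m → ℝ) :=
    fun z => (weights A x K σ *ᵥ z.2 + z.1, z.2)
  have hF : Measurable F := by
    unfold F mulVec dotProduct
    fun_prop
  have key := measure_indepFun_inter_le hR hY (hM.indepFun_residual_obsAt A x hK hσ)
    (hF hB) hE (p := p) (fun y => ?_)
  · refine le_trans (le_of_eq ?_) key
    congr 1
    ext ω
    simp only [Set.mem_ofPred_eq, Set.mem_preimage, F]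
    have : weights A x K σ *ᵥ obsAt A (h ω) (fun s => ε s ω) +
        residual A x K σ (h ω) (fun s => ε s ω) = h ω x := by
      ext j
      simp [residual]
    rw [this]
  · have hBy : MeasurableSet {z : Fin m → ℝ | z ∈ B (dataOf A y)} :=
      measurable_prodMk_right (y := y) hB
    have hBy' : MeasurableSet {z : Fin m → ℝ | (z, y) ∈ F ⁻¹'
        {z | z.1 ∈ B (dataOf A z.2)}} := measurable_prodMk_right (y := y) (hF hB)
    refine le_trans (le_of_eq ?_) (hp (dataOf A y))
    have hBe : MeasurableSet {z : EuclideanSpace ℝ (Fin m) | WithLp.ofLp z ∈ B (dataOf A y)} :=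
      (by fun_prop : Measurable fun z : EuclideanSpace ℝ (Fin m) => WithLp.ofLp z) hBy
    have hadd : Measurable fun z : EuclideanSpace ℝ (Fin m) =>
      WithLp.toLp 2 (postMean K σ (dataOf A y) x) + z := by fun_prop
    rw [multivariateGaussian_eq_map_const_add, ← hM.map_residual A x hK hσ y,
      Measure.map_apply hadd hBe, Measure.map_apply (by fun_prop) (hadd hBe),
      Measure.map_apply hR hBy']
    rfl

end Residual

end Posterior

/-! ### Quantiles of measures on the line. -/

section Quantile

variable {ν : Measure ℝ} {p : ℝ}

lemma bddBelow_quantile_set (hp : 0 < p) : BddBelow {y : ℝ | p ≤ cdf ν y} := by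
  obtain ⟨a, ha⟩ := ((tendsto_cdf_atBot ν).eventually (gt_mem_nhds hp)).exists
  refine ⟨a, fun y hy => ?_⟩
  simp only [Set.mem_ofPred_eq] at hy
  by_contra! h
  exact absurd (monotone_cdf ν h.le) (not_le.2 (ha.trans_le hy))

lemma nonempty_quantile_set (hp : p < 1) : {y : ℝ | p ≤ cdf ν y}.Nonempty := by
  obtain ⟨a, ha⟩ := ((tendsto_cdf_atTop ν).eventually (lt_mem_nhds hp)).exists
  exact ⟨a, ha.le⟩

lemma quantile_le (hp : 0 < p) {b : ℝ} (hb : p ≤ cdf ν b) : quantile ν p ≤ b :=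
  csInf_le (bddBelow_quantile_set hp) hb

/-- Right continuity of the distribution function: the infimum defining the quantile is attained. -/
lemma le_cdf_quantile (hp : p < 1) : p ≤ cdf ν (quantile ν p) := by
  have hc := ((cdf ν).right_continuous (quantile ν p)).mono Set.Ioi_subset_Ici_self
  refine ge_of_tendsto hc.tendsto ?_
  filter_upwards [self_mem_nhdsWithin] with y hy
  obtain ⟨s, hs, hsy⟩ := exists_lt_of_csInf_lt (nonempty_quantile_set hp) (Set.mem_Ioi.1 hy)
  exact le_trans (Set.mem_ofPred.1 hs) (monotone_cdf ν hsy.le)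

lemma measure_Ioi_quantile_le [IsProbabilityMeasure ν] (hp : p < 1) :
    ν (Set.Ioi (quantile ν p)) ≤ ENNReal.ofReal (1 - p) := by
  have h := le_cdf_quantile (ν := ν) hp
  rw [← Set.compl_Iic, prob_compl_eq_one_sub measurableSet_Iic, ← ofReal_cdf,
    ← ENNReal.ofReal_one, ← ENNReal.ofReal_sub _ (cdf_nonneg _ _)]
  exact ENNReal.ofReal_le_ofReal (by linarith)

lemma quantile_le_of_measure_Ioi_le [IsProbabilityMeasure ν] (hp : 0 < p) (hp1 : p ≤ 1) {b : ℝ}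
    (hb : ν (Set.Ioi b) ≤ ENNReal.ofReal (1 - p)) : quantile ν p ≤ b := by
  refine quantile_le hp ?_
  rw [← Set.compl_Iic, prob_compl_eq_one_sub measurableSet_Iic, ← ofReal_cdf,
    ← ENNReal.ofReal_one, ← ENNReal.ofReal_sub _ (cdf_nonneg _ _)] at hb
  have := (ENNReal.ofReal_le_ofReal_iff (by linarith)).1 hb
  linarith

/-- A coupling argument: when both variables live on the same space, a pointwise shift moves the
quantile by no more than the shift. -/
lemma quantile_map_le_add {α : Type*} [MeasurableSpace α] {ρ : Measure α}
    [IsProbabilityMeasure ρ] {f f' : α → ℝ} (hf : Measurable f) (hf' : Measurable f') {c : ℝ}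
    (hle : ∀ a, f a ≤ f' a + c) (hp : 0 < p) (hp1 : p < 1) :
    quantile (ρ.map f) p ≤ quantile (ρ.map f') p + c := by
  have : IsProbabilityMeasure (ρ.map f) := Measure.isProbabilityMeasure_map hf.aemeasurable
  have : IsProbabilityMeasure (ρ.map f') := Measure.isProbabilityMeasure_map hf'.aemeasurable
  refine quantile_le_of_measure_Ioi_le hp hp1.le ?_
  refine le_trans ?_ (measure_Ioi_quantile_le (ν := ρ.map f') hp1)
  rw [Measure.map_apply hf measurableSet_Ioi, Measure.map_apply hf' measurableSet_Ioi]
  refine measure_mono fun a ha => ?_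
  simp only [Set.mem_preimage, Set.mem_Ioi] at ha ⊢
  linarith [hle a]

end Quantile

/-! ### Adaptive data, decomposed by the sequence of query points. -/

section History

variable {𝒳 : Type*} {m : ℕ} (rule : (t : ℕ) → Data 𝒳 m t → 𝒳) (h : 𝒳 → Fin m → ℝ)
  (e : ℕ → Fin m → ℝ)

lemma history_eq (t : ℕ) : history rule h e t =
    fun a : Fin t => (query rule h e a, h (query rule h e a) + e a) := by
  induction t with
  | zero => funext a; exact a.elim0
  | succ t ih =>
    funext a
    refine Fin.lastCases ?_ (fun a => ?_) a
    · simp only [history, Fin.snoc_last, Fin.val_last]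
      rfl
    · simp only [history, Fin.snoc_castSucc, Fin.val_castSucc]
      exact congrFun ih a

/-- Observations `y` at the points `A` for which the rule does query the points `A`. -/
def consistentObs {t : ℕ} (A : Fin t → 𝒳) : Set (Fin t × Fin m → ℝ) :=
  {y | ∀ s : Fin t, rule s (fun r : Fin s =>
    (A (Fin.castLE s.2.le r), fun j => y (Fin.castLE s.2.le r, j))) = A s}

/-- By strong induction on time: while past queries agree with `A`, the rule sees its true history.
Hence the event of querying exactly `A` is determined by the observations at the fixed points `A`.
-/
lemma obsAt_mem_consistentObs_iff {t : ℕ} (A : Fin t → 𝒳) :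
    obsAt A h e ∈ consistentObs rule A ↔ ∀ s : Fin t, query rule h e s = A s := by
  have key : ∀ s : Fin t, (∀ r : Fin t, r < s → query rule h e r = A r) →
      rule s (fun r : Fin s => (A (Fin.castLE s.2.le r),
        fun j => obsAt A h e (Fin.castLE s.2.le r, j))) = query rule h e s := by
    intro s hs
    rw [query, history_eq]
    congr 1
    funext r
    have := hs (Fin.castLE s.2.le r) (by rw [Fin.lt_def]; exact r.2)
    simp only [Fin.val_castLE] at this
    rw [this]
    rfl
  constructor
  · intro hmem s
    induction s using WellFoundedLT.induction with
    | _ s ih => rw [← key s ih]; exact hmem s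
  · intro hq s
    rw [key s fun r _ => hq r, hq s]

lemma dataOf_obsAt {t : ℕ} {A : Fin t → 𝒳} (hA : ∀ s : Fin t, query rule h e s = A s) :
    dataOf A (obsAt A h e) = history rule h e t := by
  rw [history_eq]
  funext a
  rw [hA a]
  rfl

variable {rule} in
lemma measurableSet_consistentObs [Fintype 𝒳] [MeasurableSpace 𝒳] [MeasurableSingletonClass 𝒳]
    (hrule : ∀ t, Measurable (rule t)) {t : ℕ} (A : Fin t → 𝒳) :
    MeasurableSet (consistentObs rule A) := by
  rw [consistentObs, Set.ofPred_forall]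
  refine MeasurableSet.iInter fun s => ?_
  have hmeas : Measurable fun y : Fin t × Fin m → ℝ => rule s (fun r : Fin s =>
      (A (Fin.castLE s.2.le r), fun j => y (Fin.castLE s.2.le r, j))) := by
    refine (hrule s).comp ?_
    fun_prop
  exact hmeas (measurableSet_singleton (A s))

end History

/-! ### The confidence event and its probability. -/

section GoodEvent

variable {𝒳 : Type*} [Fintype 𝒳] {m n : ℕ} {K : 𝒳 → 𝒳 → Matrix (Fin m) (Fin m) ℝ} {σ δ : ℝ}

/-- Half-width, in units of posterior standard deviations, of the confidence intervals. -/
noncomputable def halfWidth (𝒳 : Type*) [Fintype 𝒳] (m n : ℕ) (δ : ℝ) (t : ℕ) : ℝ :=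
  Real.sqrt (beta 𝒳 m n δ (t + 1))

/-- The index shift matches `level` at time `t`, when `t` observations are available and query `t +
1` is chosen. The first `T` queries thus involve `β_1, …, β_T`. -/
lemma beta_succ (hδ : 0 < δ) (t : ℕ) [Nonempty 𝒳] :
    beta 𝒳 m n δ (t + 1) = 2 * Real.log (2 * m / level 𝒳 n δ t) := by
  have : (0 : ℝ) < Fintype.card 𝒳 := by exact_mod_cast Fintype.card_pos
  have := Real.pi_pos
  unfold beta level
  congr 2
  push_cast
  field_simp
  ring

lemma level_pos (hδ : 0 < δ) (t : ℕ) [Nonempty 𝒳] : 0 < level 𝒳 n δ t := by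
  have : (0 : ℝ) < Fintype.card 𝒳 := by exact_mod_cast Fintype.card_pos
  have := Real.pi_pos
  unfold level
  positivity

lemma level_lt_one (hδ : 0 < δ) (hδ1 : δ < 1) (t : ℕ) [Nonempty 𝒳] : level 𝒳 n δ t < 1 := by
  have hc : (1 : ℝ) ≤ Fintype.card 𝒳 := by exact_mod_cast Fintype.card_pos
  have := Real.pi_gt_three
  unfold level
  have h1 : (9 : ℝ) ≤ Real.pi ^ 2 := by nlinarith
  have h2 : (1 : ℝ) ≤ ((t : ℝ) + 1) ^ 2 := by nlinarith [(t.cast_nonneg : (0 : ℝ) ≤ t)]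
  have h3 : (1 : ℝ) ≤ (n : ℝ) + 1 := by linarith [(n.cast_nonneg : (0 : ℝ) ≤ n)]
  have h4 : (9 : ℝ) ≤ Real.pi ^ 2 * ((t : ℝ) + 1) ^ 2 * ((n : ℝ) + 1) * Fintype.card 𝒳 := by
    calc (9 : ℝ) = 9 * 1 * 1 * 1 := by norm_num
      _ ≤ _ := by gcongr
  rw [div_lt_one (by linarith)]
  linarith

lemma beta_succ_nonneg (hm : 0 < m) (hδ : 0 < δ) (hδ1 : δ < 1) (t : ℕ) [Nonempty 𝒳] :
    0 ≤ beta 𝒳 m n δ (t + 1) := by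
  rw [beta_succ hδ]
  have h1 : (1 : ℝ) ≤ m := by exact_mod_cast hm
  have h2 := level_pos (𝒳 := 𝒳) (n := n) hδ t
  have h3 := level_lt_one (𝒳 := 𝒳) (n := n) hδ hδ1 t
  refine mul_nonneg two_pos.le (Real.log_nonneg ?_)
  rw [le_div_iff₀ h2]
  linarith

lemma exp_neg_halfWidth_sq (hm : 0 < m) (hδ : 0 < δ) (hδ1 : δ < 1) (t : ℕ) [Nonempty 𝒳] :
    Real.exp (-halfWidth 𝒳 m n δ t ^ 2 / 2) = level 𝒳 n δ t / (2 * m) := by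
  have h1 : (0 : ℝ) < m := by exact_mod_cast hm
  have h2 := level_pos (𝒳 := 𝒳) (n := n) hδ t
  rw [halfWidth, Real.sq_sqrt (beta_succ_nonneg hm hδ hδ1 t), beta_succ hδ, neg_div,
    mul_div_cancel_left₀ _ (two_ne_zero), Real.exp_neg, Real.exp_log (by positivity), inv_div]

/-- Some coordinate of `z` is outside its confidence interval. -/
def outside (K : 𝒳 → 𝒳 → Matrix (Fin m) (Fin m) ℝ) (σ : ℝ) (c : ℝ) {t : ℕ} (x : 𝒳)
    (D : Data 𝒳 m t) : Set (Fin m → ℝ) :=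
  {z | ∃ j, c * Real.sqrt (postCov K σ D x j j) < |z j - postMean K σ D x j|}

/-- A union bound over the `m` one-dimensional marginals; the half-width is calibrated so that each
contributes `level / (2m)`. -/
lemma multivariateGaussian_outside_le (hK : (kernelMatrix K id).PosSemidef) (hσ : 0 < σ)
    (hm : 0 < m) (hδ : 0 < δ) (hδ1 : δ < 1) [Nonempty 𝒳] {t : ℕ} (x : 𝒳) (D : Data 𝒳 m t) :
    multivariateGaussian (WithLp.toLp 2 (postMean K σ D x)) (postCov K σ D x)
      {z | WithLp.ofLp z ∈ outside K σ (halfWidth 𝒳 m n δ t) x D} ≤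
      ENNReal.ofReal (level 𝒳 n δ t / 2) := by
  have hS := posSemidef_postCov x hK hσ D
  set c := halfWidth 𝒳 m n δ t with hc
  have hone : ∀ j, multivariateGaussian (WithLp.toLp 2 (postMean K σ D x)) (postCov K σ D x)
      {z | c * Real.sqrt (postCov K σ D x j j) < |z j - postMean K σ D x j|} ≤
      ENNReal.ofReal (level 𝒳 n δ t / (2 * m)) := by
    intro j
    have hmp := measurePreserving_eval_multivariateGaussian
      (μ := WithLp.toLp 2 (postMean K σ D x)) hS (i := j)
    have hms : MeasurableSet {y : ℝ | c * Real.sqrt (postCov K σ D x j j) <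
        |y - postMean K σ D x j|} := measurableSet_lt (by fun_prop) (by fun_prop)
    have hms' : MeasurableSet {y : ℝ | c * Real.sqrt (postCov K σ D x j j).toNNReal < |y|} :=
      measurableSet_lt (by fun_prop) (by fun_prop)
    have h2 := gaussianReal_abs_gt_le (c := c) (Real.sqrt_nonneg _) (postCov K σ D x j j).toNNReal
    rw [hc, exp_neg_halfWidth_sq hm hδ hδ1] at h2
    refine le_trans (le_of_eq ?_) h2
    have h1 := hmp.measure_preimage hms.nullMeasurableSet
    refine h1.trans ?_
    rw [← sub_self (postMean K σ D x j), ← gaussianReal_map_sub_const,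
      Measure.map_apply (by fun_prop) hms', Real.coe_toNNReal _ hS.diag_nonneg]
    rfl
  have hm' : (m : ℝ) ≠ 0 := by exact_mod_cast hm.ne'
  calc _ ≤ multivariateGaussian (WithLp.toLp 2 (postMean K σ D x)) (postCov K σ D x)
        (⋃ j, {z | c * Real.sqrt (postCov K σ D x j j) < |z j - postMean K σ D x j|}) := by
        refine measure_mono fun z hz => ?_
        obtain ⟨j, hj⟩ := hz
        exact Set.mem_iUnion.2 ⟨j, hj⟩
    _ ≤ ∑ j : Fin m, ENNReal.ofReal (level 𝒳 n δ t / (2 * m)) :=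
        (measure_iUnion_fintype_le _ _).trans (Finset.sum_le_sum fun j _ => hone j)
    _ = ENNReal.ofReal (level 𝒳 n δ t / 2) := by
        rw [Finset.sum_const, Finset.card_univ, Fintype.card_fin, nsmul_eq_mul,
          ← ENNReal.ofReal_natCast, ← ENNReal.ofReal_mul (Nat.cast_nonneg _)]
        congr 1
        field_simp

variable {g : Fin (n + 1) → 𝒳 → (Fin m → ℝ) → ℝ} {L : Fin (n + 1) → ℝ}

lemma continuous_of_abs_sub_le {φ : (Fin m → ℝ) → ℝ} {l : ℝ}
    (hφ : ∀ y z, |φ y - φ z| ≤ l * ∑ j, |y j - z j|) : Continuous φ := by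
  refine continuous_iff_continuousAt.2 fun z => tendsto_iff_dist_tendsto_zero.2 ?_
  have hlim : Filter.Tendsto (fun y : Fin m → ℝ => l * ∑ j, |y j - z j|) (nhds z) (nhds 0) := by
    have : Continuous fun y : Fin m → ℝ => l * ∑ j, |y j - z j| := by fun_prop
    simpa using this.tendsto z
  exact squeeze_zero (fun _ => dist_nonneg) (fun y => hφ y z) hlim

omit [Fintype 𝒳] in
lemma predLaw_eq_map {t : ℕ} (D : Data 𝒳 m t) (x : 𝒳) {φ : (Fin m → ℝ) → ℝ} (hφ : Continuous φ) :
    predLaw K σ D x φ = (multivariateGaussian 0 (postCov K σ D x)).map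
      (fun z => φ (postMean K σ D x + WithLp.ofLp z)) := by
  have := hφ.measurable
  rw [predLaw, multivariateGaussian_eq_map_const_add, Measure.map_map (by fun_prop) (by fun_prop)]
  rfl

omit [Fintype 𝒳] in
lemma isProbabilityMeasure_predLaw {t : ℕ} (D : Data 𝒳 m t) (x : 𝒳) {φ : (Fin m → ℝ) → ℝ}
    (hφ : Continuous φ) : IsProbabilityMeasure (predLaw K σ D x φ) := by
  have := hφ.measurable
  exact Measure.isProbabilityMeasure_map (by fun_prop)

/-- At fixed query points the predictive covariance is constant and the mean is linear in `y`, so by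
the Lipschitz condition the quantile moves by at most a multiple of the change in mean. Its use is
to make the confidence events measurable. -/
lemma continuous_upper (hL : ∀ i x y z, |g i x y - g i x z| ≤ L i * ∑ j, |y j - z j|)
    (hδ : 0 < δ) (hδ1 : δ < 1) [Nonempty 𝒳] {t : ℕ} (A : Fin t → 𝒳) (i : Fin (n + 1)) (x : 𝒳) :
    Continuous fun y : Fin t × Fin m → ℝ => upper K σ δ g (dataOf A y) i x := by
  have hg : Continuous (g i x) := continuous_of_abs_sub_le (hL i x)
  have hgm := hg.measurable
  have h2 := level_pos (𝒳 := 𝒳) (n := n) hδ t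
  have h3 := level_lt_one (𝒳 := 𝒳) (n := n) hδ hδ1 t
  have hle : ∀ y y' : Fin t × Fin m → ℝ, upper K σ δ g (dataOf A y) i x ≤
      upper K σ δ g (dataOf A y') i x +
        L i * ∑ j, |(weights A x K σ *ᵥ y) j - (weights A x K σ *ᵥ y') j| := by
    intro y y'
    unfold upper
    rw [predLaw_eq_map _ _ hg, predLaw_eq_map _ _ hg, postCov_dataOf, postCov_dataOf]
    refine quantile_map_le_add (by fun_prop) (by fun_prop) (fun z => ?_) (by linarith)
      (by linarith)
    have := (abs_le.1 (hL i x (postMean K σ (dataOf A y) x + WithLp.ofLp z)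
      (postMean K σ (dataOf A y') x + WithLp.ofLp z))).2
    simp only [Pi.add_apply, add_sub_add_right_eq_sub] at this
    rw [postMean_dataOf, postMean_dataOf] at this ⊢
    linarith
  refine continuous_iff_continuousAt.2 fun y' => tendsto_iff_dist_tendsto_zero.2 ?_
  have hlim : Filter.Tendsto (fun y : Fin t × Fin m → ℝ =>
      L i * ∑ j, |(weights A x K σ *ᵥ y) j - (weights A x K σ *ᵥ y') j|) (nhds y') (nhds 0) := by
    have : Continuous fun y : Fin t × Fin m → ℝ =>
        L i * ∑ j, |(weights A x K σ *ᵥ y) j - (weights A x K σ *ᵥ y') j| := by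
      unfold mulVec dotProduct
      fun_prop
    simpa using this.tendsto y'
  refine squeeze_zero (fun _ => dist_nonneg) (fun y => ?_) hlim
  rw [Real.dist_eq, abs_le]
  have h5 := hle y y'
  have h6 := hle y' y
  simp_rw [abs_sub_comm ((weights A x K σ *ᵥ y') _)] at h6
  constructor <;> linarith

/-- The quantile bound is at most the value at the posterior mean plus a multiple of the sum of
the posterior standard deviations. -/
lemma upper_le (hK : (kernelMatrix K id).PosSemidef) (hσ : 0 < σ) (hm : 0 < m)
    (hL : ∀ i x y z, |g i x y - g i x z| ≤ L i * ∑ j, |y j - z j|) (hL0 : ∀ i, 0 ≤ L i)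
    (hδ : 0 < δ) (hδ1 : δ < 1) [Nonempty 𝒳] {t : ℕ} (D : Data 𝒳 m t) (i : Fin (n + 1)) (x : 𝒳) :
    upper K σ δ g D i x ≤ g i x (postMean K σ D x) +
      L i * (halfWidth 𝒳 m n δ t * ∑ j, Real.sqrt (postCov K σ D x j j)) := by
  have hg : Continuous (g i x) := continuous_of_abs_sub_le (hL i x)
  have hgm := hg.measurable
  have := isProbabilityMeasure_predLaw (K := K) (σ := σ) D x hg
  have h2 := level_pos (𝒳 := 𝒳) (n := n) hδ t
  have h3 := level_lt_one (𝒳 := 𝒳) (n := n) hδ hδ1 t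
  refine quantile_le_of_measure_Ioi_le (by linarith) (by linarith) ?_
  rw [sub_sub_cancel]
  -- Inside the confidence box `g i x` does not exceed the claimed bound, and the mass outside the
  -- box is at most `level / 2`, the upper tail allowed by the quantile.
  refine le_trans ?_ (multivariateGaussian_outside_le (n := n) hK hσ hm hδ hδ1 x D)
  rw [predLaw, Measure.map_apply (by fun_prop) measurableSet_Ioi]
  refine measure_mono fun z hz => ?_
  simp only [Set.mem_preimage, Set.mem_Ioi] at hz
  by_contra hno
  simp only [outside, Set.mem_ofPred_eq, not_exists, not_lt] at hno
  have h4 := (abs_le.1 (hL i x (WithLp.ofLp z) (postMean K σ D x))).2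
  have h5 := mul_le_mul_of_nonneg_left (Finset.sum_le_sum fun j (_ : j ∈ Finset.univ) => hno j)
    (hL0 i)
  rw [← Finset.mul_sum] at h5
  linarith

/-- The confidence bounds hold at `x` and time `t`. -/
def ConfidenceHolds (K : 𝒳 → 𝒳 → Matrix (Fin m) (Fin m) ℝ) (σ δ : ℝ)
    (g : Fin (n + 1) → 𝒳 → (Fin m → ℝ) → ℝ) (f : 𝒳 → Fin m → ℝ) {t : ℕ} (D : Data 𝒳 m t) : Prop :=
  ∀ x, (∀ i, g i x (f x) ≤ upper K σ δ g D i x) ∧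
    f x ∉ outside K σ (halfWidth 𝒳 m n δ t) x D

/-- Both terms are compared with `g i x` at the posterior mean, whence the factor 2. -/
lemma ConfidenceHolds.upper_sub_le (hK : (kernelMatrix K id).PosSemidef) (hσ : 0 < σ) (hm : 0 < m)
    (hL : ∀ i x y z, |g i x y - g i x z| ≤ L i * ∑ j, |y j - z j|) (hL0 : ∀ i, 0 ≤ L i)
    (hδ : 0 < δ) (hδ1 : δ < 1) [Nonempty 𝒳] {f : 𝒳 → Fin m → ℝ} {t : ℕ} {D : Data 𝒳 m t}
    (hD : ConfidenceHolds K σ δ g f D) (i : Fin (n + 1)) (x : 𝒳) :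
    upper K σ δ g D i x - g i x (f x) ≤
      2 * L i * (halfWidth 𝒳 m n δ t * ∑ j, Real.sqrt (postCov K σ D x j j)) := by
  have h1 := upper_le hK hσ hm hL hL0 hδ hδ1 D i x
  have hno := (hD x).2
  simp only [outside, Set.mem_ofPred_eq, not_exists, not_lt] at hno
  have h4 := (abs_le.1 (hL i x (f x) (postMean K σ D x))).1
  have h5 := mul_le_mul_of_nonneg_left (Finset.sum_le_sum fun j (_ : j ∈ Finset.univ) => hno j)
    (hL0 i)
  rw [← Finset.mul_sum] at h5
  linarith

variable [DecidableEq 𝒳] [MeasurableSpace 𝒳] [MeasurableSingletonClass 𝒳]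
  {Ω : Type*} [MeasurableSpace Ω] {μ : Measure Ω} [IsProbabilityMeasure μ]
  {h : Ω → 𝒳 → Fin m → ℝ} {ε : ℕ → Ω → Fin m → ℝ} {rule : (t : ℕ) → Data 𝒳 m t → 𝒳}

/-- The posterior given adaptively collected data controls probabilities of events about `h(x)`. -/
lemma IsGPModel.measure_history_mem_le (hM : IsGPModel μ K σ h ε)
    (hK : (kernelMatrix K id).PosSemidef) (hσ : 0 < σ) (hrule : ∀ t, Measurable (rule t))
    {t : ℕ} (x : 𝒳) {B : Data 𝒳 m t → Set (Fin m → ℝ)}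
    (hB : ∀ A : Fin t → 𝒳,
      MeasurableSet {z : (Fin m → ℝ) × (Fin t × Fin m → ℝ) | z.1 ∈ B (dataOf A z.2)})
    {p : ENNReal} (hp : ∀ D, multivariateGaussian (WithLp.toLp 2 (postMean K σ D x))
      (postCov K σ D x) {z | WithLp.ofLp z ∈ B D} ≤ p) :
    μ {ω | h ω x ∈ B (history rule (h ω) (fun s => ε s ω) t)} ≤ p := by
  -- These events partition the space by the first `t` queries. On `E A` the adaptive history equals
  -- the fixed-design data at `A`.
  let E : (Fin t → 𝒳) → Set Ω := fun A =>
    (fun ω => obsAt A (h ω) (fun s => ε s ω)) ⁻¹' consistentObs rule A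
  have hE : ∀ A, MeasurableSet (E A) := fun A =>
    measurable_obsAt A hM.measurable_h hM.measurable_noise (measurableSet_consistentObs hrule A)
  have hEq : ∀ A ω, ω ∈ E A ↔ ∀ s : Fin t, query rule (h ω) (fun s => ε s ω) s = A s :=
    fun A ω => obsAt_mem_consistentObs_iff rule (h ω) (fun s => ε s ω) A
  have hdisj : Pairwise (Function.onFun Disjoint E) := by
    intro A A' hne
    refine Set.disjoint_left.2 fun ω h1 h2 => hne ?_
    funext s
    rw [← (hEq A ω).1 h1 s, (hEq A' ω).1 h2 s]
  calc μ {ω | h ω x ∈ B (history rule (h ω) (fun s => ε s ω) t)}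
      ≤ μ (⋃ A : Fin t → 𝒳, {ω | obsAt A (h ω) (fun s => ε s ω) ∈ consistentObs rule A ∧
          h ω x ∈ B (dataOf A (obsAt A (h ω) (fun s => ε s ω)))}) := by
        refine measure_mono fun ω hω => ?_
        have hA : ∀ s : Fin t, query rule (h ω) (fun s => ε s ω) s =
          (fun s : Fin t => query rule (h ω) (fun s => ε s ω) s) s := fun s => rfl
        refine Set.mem_iUnion.2 ⟨_, (obsAt_mem_consistentObs_iff rule _ _ _).2 hA, ?_⟩
        rw [dataOf_obsAt rule (h ω) (fun s => ε s ω) hA]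
        exact hω
    _ ≤ ∑ A : Fin t → 𝒳, μ {ω | obsAt A (h ω) (fun s => ε s ω) ∈ consistentObs rule A ∧
          h ω x ∈ B (dataOf A (obsAt A (h ω) (fun s => ε s ω)))} := measure_iUnion_fintype_le _ _
    -- Each piece is charged in proportion to its own measure, so the number of query sequences does
    -- not enter the bound.
    _ ≤ ∑ A : Fin t → 𝒳, p * μ (E A) := Finset.sum_le_sum fun A _ =>
        hM.measure_obsAt_mem_le A x hK hσ (hB A) hp (measurableSet_consistentObs hrule A)
    _ = p * μ (⋃ A, E A) := by
        rw [← Finset.mul_sum, measure_iUnion hdisj hE, tsum_fintype]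
    _ ≤ p := by
        conv_rhs => rw [← mul_one p]
        gcongr
        exact prob_le_one

/-- With probability at least `1 - δ` all confidence bounds hold at all times. -/
lemma IsGPModel.measure_not_confidenceHolds_le (hM : IsGPModel μ K σ h ε)
    (hK : (kernelMatrix K id).PosSemidef) (hσ : 0 < σ) (hm : 0 < m)
    (hL : ∀ i x y z, |g i x y - g i x z| ≤ L i * ∑ j, |y j - z j|)
    (hrule : ∀ t, Measurable (rule t)) (hδ : 0 < δ) (hδ1 : δ < 1) [Nonempty 𝒳] :
    μ {ω | ¬ ∀ t, ConfidenceHolds K σ δ g (h ω) (history rule (h ω) (fun s => ε s ω) t)} ≤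
      ENNReal.ofReal δ := by
  have hupper : ∀ t i x, μ {ω | h ω x ∈ {z | upper K σ δ g
      (history rule (h ω) (fun s => ε s ω) t) i x < g i x z}} ≤
      ENNReal.ofReal (level 𝒳 n δ t / 2) := by
    intro t i x
    have hg : Continuous (g i x) := continuous_of_abs_sub_le (hL i x)
    have hgm := hg.measurable
    have h2 := level_pos (𝒳 := 𝒳) (n := n) hδ t
    refine hM.measure_history_mem_le hK hσ hrule x
      (B := fun D => {z | upper K σ δ g D i x < g i x z}) (fun A => ?_) (fun D => ?_)
    · have := (continuous_upper (K := K) (σ := σ) hL hδ hδ1 A i x).measurable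
      exact measurableSet_lt (this.comp measurable_snd) (hgm.comp measurable_fst)
    · have := isProbabilityMeasure_predLaw (K := K) (σ := σ) D x hg
      have h1 := measure_Ioi_quantile_le (ν := predLaw K σ D x (g i x))
        (p := 1 - level 𝒳 n δ t / 2) (by linarith)
      rw [sub_sub_cancel, predLaw, Measure.map_apply (by fun_prop) measurableSet_Ioi] at h1
      exact h1
  have hout : ∀ t x, μ {ω | h ω x ∈ outside K σ (halfWidth 𝒳 m n δ t) x
      (history rule (h ω) (fun s => ε s ω) t)} ≤ ENNReal.ofReal (level 𝒳 n δ t / 2) := by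
    intro t x
    refine hM.measure_history_mem_le hK hσ hrule x (fun A => ?_)
      (multivariateGaussian_outside_le hK hσ hm hδ hδ1 x)
    simp only [outside, Set.mem_ofPred_eq, postCov_dataOf, postMean_dataOf]
    rw [Set.ofPred_exists]
    refine MeasurableSet.iUnion fun j => ?_
    refine measurableSet_lt measurable_const ?_
    unfold mulVec dotProduct
    fun_prop
  have hcard : (0 : ℝ) < Fintype.card 𝒳 := by exact_mod_cast Fintype.card_pos
  have hbad : ∀ t, μ {ω | ¬ ConfidenceHolds K σ δ g (h ω)
      (history rule (h ω) (fun s => ε s ω) t)} ≤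
      ENNReal.ofReal (δ * (6 / Real.pi ^ 2 * (1 / ((t : ℝ) + 1) ^ 2))) := by
    intro t
    have h2 := level_pos (𝒳 := 𝒳) (n := n) hδ t
    calc _ ≤ μ (⋃ x, ((⋃ i, {ω | h ω x ∈ {z | upper K σ δ g
          (history rule (h ω) (fun s => ε s ω) t) i x < g i x z}}) ∪
          {ω | h ω x ∈ outside K σ (halfWidth 𝒳 m n δ t) x
            (history rule (h ω) (fun s => ε s ω) t)})) := by
          refine measure_mono fun ω hω => ?_
          simp only [ConfidenceHolds, Set.mem_ofPred_eq, not_forall] at hω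
          obtain ⟨x, hx⟩ := hω
          refine Set.mem_iUnion.2 ⟨x, ?_⟩
          by_cases ho : h ω x ∈ outside K σ (halfWidth 𝒳 m n δ t) x
            (history rule (h ω) (fun s => ε s ω) t)
          · exact Or.inr ho
          · refine Or.inl ?_
            have : ¬ ∀ i, g i x (h ω x) ≤ upper K σ δ g
              (history rule (h ω) (fun s => ε s ω) t) i x := fun hall => hx ⟨hall, ho⟩
            push Not at this
            obtain ⟨i, hi⟩ := this
            exact Set.mem_iUnion.2 ⟨i, hi⟩
      _ ≤ ∑ x : 𝒳, (∑ i : Fin (n + 1), ENNReal.ofReal (level 𝒳 n δ t / 2) +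
          ENNReal.ofReal (level 𝒳 n δ t / 2)) := by
          refine (measure_iUnion_fintype_le _ _).trans (Finset.sum_le_sum fun x _ => ?_)
          refine (measure_union_le _ _).trans (add_le_add ?_ (hout t x))
          exact (measure_iUnion_fintype_le _ _).trans (Finset.sum_le_sum fun i _ => hupper t i x)
      _ = ENNReal.ofReal (Fintype.card 𝒳 * ((n + 1) * (level 𝒳 n δ t / 2) +
          level 𝒳 n δ t / 2)) := by
          rw [Finset.sum_const, Finset.sum_const, Finset.card_univ, Finset.card_univ,
            Fintype.card_fin, nsmul_eq_mul, nsmul_eq_mul, ← ENNReal.ofReal_natCast,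
            ← ENNReal.ofReal_natCast, ← ENNReal.ofReal_mul (Nat.cast_nonneg _),
            ← ENNReal.ofReal_add (by positivity) (by positivity),
            ← ENNReal.ofReal_mul (Nat.cast_nonneg _)]
          push_cast
          rfl
      -- Each point has `n + 1` quantile events and a single box event, all of size `level / 2`; and
      -- `(n + 2) / 2 ≤ n + 1`.
      _ ≤ ENNReal.ofReal (Fintype.card 𝒳 * ((n + 1) * level 𝒳 n δ t)) := by
          refine ENNReal.ofReal_le_ofReal (mul_le_mul_of_nonneg_left ?_ hcard.le)
          nlinarith [(n.cast_nonneg : (0 : ℝ) ≤ n)]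
      _ = _ := by
          congr 1
          have := Real.pi_pos
          unfold level
          field_simp
  -- The Basel sum. The removed term at index `0` is `1 / 0 ^ 2`, which is `0` by convention.
  have hsum : HasSum (fun t : ℕ => δ * (6 / Real.pi ^ 2 * (1 / ((t : ℝ) + 1) ^ 2))) δ := by
    have h1 := (hasSum_nat_add_iff' 1).2 hasSum_zeta_two
    simp only [Finset.sum_range_one, Nat.cast_zero, Nat.cast_add, Nat.cast_one] at h1
    have h2 := (h1.mul_left (6 / Real.pi ^ 2)).mul_left δ
    have h3 : δ * (6 / Real.pi ^ 2 * (Real.pi ^ 2 / 6 - 1 / 0 ^ 2)) = δ := by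
      norm_num
    rwa [h3] at h2
  calc _ ≤ μ (⋃ t, {ω | ¬ ConfidenceHolds K σ δ g (h ω)
        (history rule (h ω) (fun s => ε s ω) t)}) := by
        refine measure_mono fun ω hω => ?_
        simp only [Set.mem_ofPred_eq, not_forall] at hω
        exact Set.mem_iUnion.2 hω
    _ ≤ ∑' t : ℕ, ENNReal.ofReal (δ * (6 / Real.pi ^ 2 * (1 / ((t : ℝ) + 1) ^ 2))) :=
        (measure_iUnion_le _).trans (ENNReal.tsum_le_tsum hbad)
    _ = ENNReal.ofReal δ := by
        rw [← ENNReal.ofReal_tsum_of_nonneg (fun t => by positivity) hsum.summable, hsum.tsum_eq]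

end GoodEvent

/-! ### Posterior variances and the information gain. -/

section InformationGain

/-- From `log (1 + u) ≥ u / (1 + u)` at `u = v / c`. It turns variances into information increments.
-/
lemma le_mul_log_one_add {c B v : ℝ} (hc : 0 < c) (hv : 0 ≤ v) (hvB : v ≤ B) :
    v ≤ (c + B) * Real.log (1 + c⁻¹ * v) := by
  have h1 := Real.one_sub_inv_le_log_of_pos (x := 1 + c⁻¹ * v) (by positivity)
  have h2 : 1 - (1 + c⁻¹ * v)⁻¹ = v / (c + v) := by
    field_simp
    ring
  rw [h2] at h1
  calc v = (c + v) * (v / (c + v)) := by field_simp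
    _ ≤ (c + B) * Real.log (1 + c⁻¹ * v) := by gcongr; linarith

/-- The chain rule for information, by adding one observation at a time. -/
lemma log_det_eq_sum {κ : Type*} [Fintype κ] {G : Matrix κ κ ℝ} (hG : G.PosSemidef) {c : ℝ}
    (hc : 0 < c) (a : ℕ → κ) (T : ℕ) :
    Real.log (1 + c⁻¹ • G.submatrix (fun s : Fin T => a s) (fun s : Fin T => a s)).det =
      ∑ t ∈ Finset.range T, Real.log (1 + c⁻¹ * condVar G c (fun s : Fin t => a s) (a t)) := by
  induction T with
  | zero => simp
  | succ T ih =>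
    have hsnoc : (fun s : Fin (T + 1) => a s) =
        (Fin.snoc (fun s : Fin T => a s) (a T) : Fin (T + 1) → κ) := by
      funext s
      refine Fin.lastCases ?_ (fun s => ?_) s
      · simp
      · simp
    have hpos : 0 < 1 + c⁻¹ * condVar G c (fun s : Fin T => a s) (a T) := by
      have := condVar_nonneg hG hc (fun s : Fin T => a s) (a T)
      positivity
    have hdet : (1 + c⁻¹ • G.submatrix (fun s : Fin T => a s) (fun s : Fin T => a s)).det ≠ 0 := by
      have : (1 + c⁻¹ • G.submatrix (fun s : Fin T => a s) (fun s : Fin T => a s)).PosDef :=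
        PosDef.one.add_posSemidef ((hG.submatrix _).smul (inv_pos.2 hc).le)
      exact this.det_pos.ne'
    rw [hsnoc, det_one_add_smul_snoc hG hc, Real.log_mul hdet hpos.ne', ih,
      Finset.sum_range_succ]

variable {𝒳 : Type*} [Fintype 𝒳] {m n : ℕ} {K : 𝒳 → 𝒳 → Matrix (Fin m) (Fin m) ℝ} {σ δ : ℝ}

lemma sum_log_le_infoGain (hK : (kernelMatrix K id).PosSemidef) (hσ : 0 < σ) (a : ℕ → 𝒳)
    (j : Fin m) (T : ℕ) :
    ∑ t ∈ Finset.range T, Real.log (1 + (σ ^ 2)⁻¹ *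
      condVar (kernelMatrix K id) (σ ^ 2) (fun s : Fin t => (a s, j)) (a t, j)) ≤
      2 * infoGain K σ j T := by
  have h1 := le_ciSup (f := fun A : Fin T → 𝒳 => (1 / 2 : ℝ) * Real.log
    ((1 + (σ ^ 2)⁻¹ • Matrix.of fun a b : Fin T => K (A a) (A b) j j).det))
    (Set.finite_range _).bddAbove (fun s : Fin T => a s)
  have h2 := log_det_eq_sum hK (pow_pos hσ 2) (fun t => (a t, j)) T
  rw [← h2]
  have h3 : Real.log ((1 + (σ ^ 2)⁻¹ • (kernelMatrix K id).submatrix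
      (fun s : Fin T => (a s, j)) (fun s : Fin T => (a s, j))).det) =
      Real.log ((1 + (σ ^ 2)⁻¹ • Matrix.of fun s b : Fin T => K (a s) (a b) j j).det) := rfl
  rw [h3]
  unfold infoGain
  simp only at h1
  linarith

lemma infoGain_nonneg [Nonempty 𝒳] (hK : (kernelMatrix K id).PosSemidef) (hσ : 0 < σ)
    (j : Fin m) (T : ℕ) : 0 ≤ infoGain K σ j T := by
  have x : 𝒳 := Classical.arbitrary 𝒳
  have h1 := sum_log_le_infoGain hK hσ (fun _ => x) j T
  have h2 : 0 ≤ ∑ t ∈ Finset.range T, Real.log (1 + (σ ^ 2)⁻¹ *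
      condVar (kernelMatrix K id) (σ ^ 2) (fun _ : Fin t => (x, j)) (x, j)) := by
    refine Finset.sum_nonneg fun t _ => Real.log_nonneg ?_
    have := condVar_nonneg hK (pow_pos hσ 2) (fun _ : Fin t => (x, j)) (x, j)
    have : 0 ≤ (σ ^ 2)⁻¹ * condVar (kernelMatrix K id) (σ ^ 2) (fun _ : Fin t => (x, j)) (x, j) :=
      by positivity
    linarith
  linarith

omit [Fintype 𝒳] in
lemma infoGain_le_infoGainMax (j : Fin m) (T : ℕ) : infoGain K σ j T ≤ infoGainMax K σ T :=
  le_ciSup (f := fun j : Fin m => infoGain K σ j T) (Set.finite_range _).bddAbove j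

/-- The posterior standard deviations at the query points are bounded in terms of the information
gain. -/
lemma sum_sqrt_postCov_le (hK : (kernelMatrix K id).PosSemidef) (hσ : 0 < σ) {B : ℝ}
    (j : Fin m) (hB : ∀ x, K x x j j ≤ B) (rule : (t : ℕ) → Data 𝒳 m t → 𝒳)
    (h : 𝒳 → Fin m → ℝ) (e : ℕ → Fin m → ℝ) (T : ℕ) :
    ∑ t ∈ Finset.range T, Real.sqrt (postCov K σ (history rule h e t) (query rule h e t) j j) ≤
      Real.sqrt (T * ((σ ^ 2 + B) * (2 * infoGain K σ j T))) := by
  set G := kernelMatrix K id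
  set a := query rule h e with ha
  have hs2 : 0 < σ ^ 2 := pow_pos hσ 2
  -- The posterior uses all `m` outputs. Keeping only the observations of output `j` enlarges the
  -- variance and leads to the scalar kernel that defines `γ_{j,T}`.
  have hle : ∀ t, postCov K σ (history rule h e t) (a t) j j ≤
      condVar G (σ ^ 2) (fun s : Fin t => (a s, j)) (a t, j) := by
    intro t
    have h1 : postCov K σ (history rule h e t) (a t) j j = condVar G (σ ^ 2)
        (fun p : Fin t × Fin m => ((history rule h e t p.1).1, p.2)) (a t, j) :=
      condVar_eq_condCov G (σ ^ 2) (fun p : Fin t × Fin m => ((history rule h e t p.1).1, p.2))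
        (fun j : Fin m => (a t, j)) j
    rw [h1, history_eq]
    exact condVar_le_condVar_comp hK hs2 (fun p : Fin t × Fin m => (a p.1, p.2))
      (e := fun s : Fin t => (s, j)) (fun s s' hss => congrArg Prod.fst hss) (a t, j)
  have hB0 : 0 ≤ B := le_trans (hK.diag_nonneg (i := (a 0, j))) (hB (a 0))
  have h0 : ∀ t, 0 ≤ postCov K σ (history rule h e t) (a t) j j := fun t =>
    (posSemidef_postCov (a t) hK hσ _).diag_nonneg
  refine Real.le_sqrt_of_sq_le ?_
  -- Cauchy–Schwarz over the `T` queries.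
  refine (sq_sum_le_card_mul_sum_sq).trans ?_
  rw [Finset.card_range]
  refine mul_le_mul_of_nonneg_left ?_ (Nat.cast_nonneg _)
  refine le_trans ?_ (mul_le_mul_of_nonneg_left (sum_log_le_infoGain hK hσ a j T) (by positivity))
  rw [Finset.mul_sum]
  refine Finset.sum_le_sum fun t _ => ?_
  rw [Real.sq_sqrt (h0 t)]
  exact (hle t).trans (le_mul_log_one_add hs2 ((h0 t).trans (hle t))
    ((condVar_le_self hK hs2 _ _).trans (hB _)))

end InformationGain

/-! ### Regret and violations on the confidence event. -/

section Regret

variable {𝒳 : Type*} [Fintype 𝒳] [Nonempty 𝒳] {m n : ℕ}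
  {K : 𝒳 → 𝒳 → Matrix (Fin m) (Fin m) ℝ} {σ δ : ℝ}
  {g : Fin (n + 1) → 𝒳 → (Fin m → ℝ) → ℝ} {L : Fin (n + 1) → ℝ}
  {rule : (t : ℕ) → Data 𝒳 m t → 𝒳}

omit [Nonempty 𝒳] in
lemma FindsWithin.mono {h : 𝒳 → Fin m → ℝ} {e : ℕ → Fin m → ℝ} {T : ℕ} {b b' : ℝ} (hb : b ≤ b')
    (H : FindsWithin K σ δ g rule h e T b) : FindsWithin K σ δ g rule h e T b' := by
  obtain ⟨h1, t, ht, h2, h3⟩ := H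
  exact ⟨h1, t, ht, h2.trans hb, fun i => (h3 i).trans hb⟩

-- Test the Lipschitz bound on the constant vectors `1` and `0`, whose distance `m` is positive.
omit [Fintype 𝒳] in
lemma lipschitz_const_nonneg (hm : 0 < m)
    (hL : ∀ i x y z, |g i x y - g i x z| ≤ L i * ∑ j, |y j - z j|) (i : Fin (n + 1)) :
    0 ≤ L i := by
  have h1 := (abs_nonneg _).trans (hL i (Classical.arbitrary 𝒳) 1 0)
  have hm' : (0 : ℝ) < m := by exact_mod_cast hm
  simp only [Pi.one_apply, Pi.zero_apply, sub_zero, abs_one, Finset.sum_const, Finset.card_univ,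
    Fintype.card_fin, nsmul_eq_mul, mul_one] at h1
  exact nonneg_of_mul_nonneg_left h1 hm'

lemma beta_mono (hm : 0 < m) (hδ : 0 < δ) {s t : ℕ} (hs : 1 ≤ s) (hst : s ≤ t) :
    beta 𝒳 m n δ s ≤ beta 𝒳 m n δ t := by
  have h1 : (0 : ℝ) < Fintype.card 𝒳 := by exact_mod_cast Fintype.card_pos
  have h2 : (0 : ℝ) < m := by exact_mod_cast hm
  have h3 : (0 : ℝ) < s := by exact_mod_cast hs
  have h4 : (s : ℝ) ≤ t := by exact_mod_cast hst
  have := Real.pi_pos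
  unfold beta
  gcongr

/-- On the event that the confidence bounds hold, some query has small regret and violations. -/
theorem findsWithin_of_confidenceHolds (hm : 0 < m) (hK : (kernelMatrix K id).PosSemidef)
    (hσ : 0 < σ) (hδ0 : 0 < δ) (hδ1 : δ < 1)
    (hL : ∀ i x y z, |g i x y - g i x z| ≤ L i * ∑ j, |y j - z j|)
    (hsolves : ∀ (t : ℕ) (D : Data 𝒳 m t), (∃ x, AuxFeasible K σ δ g D x) →
      SolvesAux K σ δ g D (rule t D))
    {h : 𝒳 → Fin m → ℝ} {e : ℕ → Fin m → ℝ}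
    (hconf : ∀ t, ConfidenceHolds K σ δ g h (history rule h e t))
    (hfeas : ∃ x, IsFeasible g h x) {B : ℝ} (hB : ∀ x j, K x x j j ≤ B) {T : ℕ} (hT : 1 ≤ T) :
    FindsWithin K σ δ g rule h e T (2 * (∑ i, L i) * Real.sqrt (beta 𝒳 m n δ T) *
      (∑ j, Real.sqrt (T * ((σ ^ 2 + B) * (2 * infoGain K σ j T)))) / T) := by
  have hL0 := lipschitz_const_nonneg hm hL
  have hT0 : (0 : ℝ) < T := by exact_mod_cast hT
  have haux : ∀ t x, IsFeasible g h x → AuxFeasible K σ δ g (history rule h e t) x :=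
    fun t x hx i => (hx i).trans ((hconf t x).1 i.succ)
  have hsol : ∀ t, SolvesAux K σ δ g (history rule h e t) (query rule h e t) := fun t => by
    obtain ⟨x, hx⟩ := hfeas
    exact hsolves t _ ⟨x, haux t x hx⟩
  refine ⟨fun t _ => ⟨?_, hsol t⟩, ?_⟩
  · rintro ⟨i, hi⟩
    obtain ⟨x, hx⟩ := hfeas
    exact absurd (haux t x hx i) (not_le.2 (hi x))
  set S : ℕ → ℝ := fun t =>
    ∑ j, Real.sqrt (postCov K σ (history rule h e t) (query rule h e t) j j) with hS
  have hsum : ∑ t ∈ Finset.range T, S t ≤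
      ∑ j, Real.sqrt (T * ((σ ^ 2 + B) * (2 * infoGain K σ j T))) := by
    rw [hS, Finset.sum_comm]
    exact Finset.sum_le_sum fun j _ =>
      sum_sqrt_postCov_le hK hσ j (fun x => hB x j) rule h e T
  set M := ∑ j, Real.sqrt (T * ((σ ^ 2 + B) * (2 * infoGain K σ j T))) with hM
  -- Some query does no worse than the average. As `S` does not involve `i`, the same `t` works for
  -- the objective and every constraint.
  obtain ⟨t, ht, hmin⟩ : ∃ t ∈ Finset.range T, S t ≤ M / T := by
    refine Finset.exists_le_of_sum_le ⟨0, Finset.mem_range.2 hT⟩ ?_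
    rw [Finset.sum_const, Finset.card_range, nsmul_eq_mul, mul_div_cancel₀ _ hT0.ne']
    exact hsum
  have htT := Finset.mem_range.1 ht
  have hS0 : 0 ≤ S t := Finset.sum_nonneg fun j _ => Real.sqrt_nonneg _
  have hgap : ∀ i, upper K σ δ g (history rule h e t) i (query rule h e t) -
      g i (query rule h e t) (h (query rule h e t)) ≤
      2 * (∑ i, L i) * Real.sqrt (beta 𝒳 m n δ T) * M / T := by
    intro i
    refine ((hconf t).upper_sub_le hK hσ hm hL hL0 hδ0 hδ1 i _).trans ?_
    have h1 : L i ≤ ∑ i, L i := Finset.single_le_sum (fun i _ => hL0 i) (Finset.mem_univ i)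
    have h2 : halfWidth 𝒳 m n δ t ≤ Real.sqrt (beta 𝒳 m n δ T) :=
      Real.sqrt_le_sqrt (beta_mono hm hδ0 (by omega) (by omega))
    have h3 : 0 ≤ halfWidth 𝒳 m n δ t := Real.sqrt_nonneg _
    have h4 : 0 ≤ ∑ i, L i := Finset.sum_nonneg fun i _ => hL0 i
    calc 2 * L i * (halfWidth 𝒳 m n δ t * S t)
        ≤ 2 * (∑ i, L i) * (Real.sqrt (beta 𝒳 m n δ T) * (M / T)) := by gcongr
      _ = _ := by ring
  refine ⟨t, htT, ?_, fun i => max_le ?_ ?_⟩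
  -- Optimism: feasible points compete in the auxiliary problem, and their bounds dominate their
  -- true values.
  · have hopt : optValue g h ≤ upper K σ δ g (history rule h e t) 0 (query rule h e t) := by
      refine csSup_le ?_ ?_
      · obtain ⟨x, hx⟩ := hfeas
        exact ⟨_, x, hx, rfl⟩
      · rintro _ ⟨x, hx, rfl⟩
        exact ((hconf t x).1 0).trans ((hsol t).2 x (haux t x hx))
    linarith [hgap 0]
  · have := (hsol t).1 i
    linarith [hgap i.succ]
  · have h4 : 0 ≤ ∑ i, L i := Finset.sum_nonneg fun i _ => hL0 i
    have h5 : 0 ≤ M := Finset.sum_nonneg fun j _ => Real.sqrt_nonneg _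
    positivity

end Regret

/-! ### Comparison of the pathwise bound with the stated rates. -/

section Rates

variable {𝒳 : Type*} [Fintype 𝒳] [Nonempty 𝒳] {m n : ℕ}
  {K : 𝒳 → 𝒳 → Matrix (Fin m) (Fin m) ℝ} {σ δ : ℝ} {L : Fin (n + 1) → ℝ}

variable (𝒳 m n δ) in
/-- Constant in the logarithmic bound for `β_T`. -/
noncomputable def betaConst : ℝ :=
  Real.sqrt (2 * |Real.log ((m : ℝ) * Real.pi ^ 2 * ((n : ℝ) + 1) * (Fintype.card 𝒳 : ℝ) /
    (3 * δ))| + 4)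

lemma sqrt_beta_le (hm : 0 < m) (hδ : 0 < δ) {T : ℕ} (hT : 1 ≤ T) :
    Real.sqrt (beta 𝒳 m n δ T) ≤ betaConst 𝒳 m n δ * (1 + Real.log T) := by
  have h1 : (0 : ℝ) < Fintype.card 𝒳 := by exact_mod_cast Fintype.card_pos
  have h2 : (0 : ℝ) < m := by exact_mod_cast hm
  have h3 : (1 : ℝ) ≤ T := by exact_mod_cast hT
  have hlog := Real.log_nonneg h3
  have := Real.pi_pos
  set c := (m : ℝ) * Real.pi ^ 2 * ((n : ℝ) + 1) * (Fintype.card 𝒳 : ℝ) / (3 * δ) with hc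
  have hc0 : 0 < c := by positivity
  have hb : beta 𝒳 m n δ T = 2 * (Real.log c + 2 * Real.log T) := by
    have : (m : ℝ) * Real.pi ^ 2 * (T : ℝ) ^ 2 * ((n : ℝ) + 1) * (Fintype.card 𝒳 : ℝ) / (3 * δ) =
        c * (T : ℝ) ^ 2 := by rw [hc]; ring
    rw [beta, this, Real.log_mul hc0.ne' (by positivity), Real.log_pow]
    push_cast
    ring
  refine Real.sqrt_le_iff.2 ⟨mul_nonneg (Real.sqrt_nonneg _) (by linarith), ?_⟩
  rw [mul_pow, betaConst, Real.sq_sqrt (by positivity), hb]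
  have ha := le_abs_self (Real.log c)
  have ha0 := abs_nonneg (Real.log c)
  -- Deliberately crude: it gives up the square root of the logarithm to obtain the integer exponent
  -- `p = 1`.
  have hsq : 1 + Real.log T ≤ (1 + Real.log T) ^ 2 := by nlinarith
  calc 2 * (Real.log c + 2 * Real.log T)
      ≤ (2 * |Real.log c| + 4) * (1 + Real.log T) := by nlinarith [mul_nonneg ha0 hlog]
    _ ≤ (2 * |Real.log c| + 4) * (1 + Real.log T) ^ 2 := by gcongr

lemma infoGainMax_nonneg (hm : 0 < m) (hK : (kernelMatrix K id).PosSemidef) (hσ : 0 < σ)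
    (T : ℕ) : 0 ≤ infoGainMax K σ T :=
  (infoGain_nonneg hK hσ ⟨0, hm⟩ T).trans (infoGain_le_infoGainMax _ T)

lemma sum_sqrt_mul_infoGain_le (hm : 0 < m) (hK : (kernelMatrix K id).PosSemidef) (hσ : 0 < σ)
    {T : ℕ} (hT : 1 ≤ T) {a c : ℝ} (hc : 0 ≤ c) (hac : a ≤ c * T) :
    (∑ j : Fin m, Real.sqrt (a * infoGain K σ j T)) / T ≤
      m * Real.sqrt c * Real.sqrt (infoGainMax K σ T / T) := by
  have hT0 : (0 : ℝ) < T := by exact_mod_cast hT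
  have hγ := infoGainMax_nonneg hm hK hσ T
  rw [div_le_iff₀ hT0]
  have : ∀ j ∈ (Finset.univ : Finset (Fin m)), Real.sqrt (a * infoGain K σ j T) ≤
      Real.sqrt c * Real.sqrt (infoGainMax K σ T / T) * T := by
    intro j _
    rw [← Real.sqrt_mul hc]
    refine Real.sqrt_le_iff.2 ⟨by positivity, ?_⟩
    rw [mul_pow, Real.sq_sqrt (by positivity)]
    calc a * infoGain K σ j T ≤ c * T * infoGainMax K σ T := by
          have := infoGain_nonneg hK hσ j T
          gcongr
          exact infoGain_le_infoGainMax j T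
      _ = c * (infoGainMax K σ T / T) * T ^ 2 := by field_simp
  refine (Finset.sum_le_sum this).trans (le_of_eq ?_)
  rw [Finset.sum_const, Finset.card_univ, Fintype.card_fin, nsmul_eq_mul]
  ring

lemma rateBound_isBigO (hm : 0 < m) (hK : (kernelMatrix K id).PosSemidef) (hσ : 0 < σ)
    (hδ : 0 < δ) (hL0 : ∀ i, 0 ≤ L i) :
    rateBound (𝒳 := 𝒳) K σ δ L =O[Filter.atTop]
      fun T : ℕ => Real.log T ^ 1 * Real.sqrt (infoGainMax K σ T / T) := by
  have hLs : 0 ≤ ∑ i, L i := Finset.sum_nonneg fun i _ => hL0 i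
  refine Asymptotics.IsBigO.of_bound
    (4 * (∑ i, L i) * (betaConst 𝒳 m n δ * 2) * (m * Real.sqrt 3)) ?_
  -- `T ≥ 3` makes `log T ≥ 1`, so `1 + log T ≤ 2 log T`; the constant `3` under the root comes from
  -- `T + 2 ≤ 3 T`.
  filter_upwards [Filter.eventually_ge_atTop 3] with T hT
  have hT3 : (3 : ℝ) ≤ T := by exact_mod_cast hT
  have hlog : 1 ≤ Real.log T := by
    rw [Real.le_log_iff_exp_le (by linarith)]
    linarith [Real.exp_one_lt_d9]
  have h1 := sqrt_beta_le (𝒳 := 𝒳) (n := n) hm hδ (show 1 ≤ T by omega)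
  have h2 := sum_sqrt_mul_infoGain_le hm hK hσ (show 1 ≤ T by omega)
    (a := (T : ℝ) + 2) (c := 3) (by norm_num) (by linarith)
  have hb0 : 0 ≤ betaConst 𝒳 m n δ := Real.sqrt_nonneg _
  have hΨ : 0 ≤ Psi K σ T := Finset.sum_nonneg fun j _ => Real.sqrt_nonneg _
  rw [Real.norm_of_nonneg (by unfold rateBound; positivity), Real.norm_of_nonneg (by positivity),
    pow_one]
  calc rateBound (𝒳 := 𝒳) K σ δ L T
      = 4 * (∑ i, L i) * Real.sqrt (beta 𝒳 m n δ T) * (Psi K σ T / T) := by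
        unfold rateBound; ring
    _ ≤ 4 * (∑ i, L i) * (betaConst 𝒳 m n δ * (2 * Real.log T)) *
        (m * Real.sqrt 3 * Real.sqrt (infoGainMax K σ T / T)) := by
        have h3 : Real.sqrt (beta 𝒳 m n δ T) ≤ betaConst 𝒳 m n δ * (2 * Real.log T) :=
          h1.trans (by gcongr; linarith)
        have h4 : Psi K σ T / T ≤ m * Real.sqrt 3 * Real.sqrt (infoGainMax K σ T / T) := h2
        gcongr
    _ = _ := by ring

/-- The noise condition says `T σ² ≤ T + 2`, so `2 T (σ² + 1) ≤ 4 (T + 2)`. This is the role of the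
`+ 2` in `Ψ_T`, and the root of `4` supplies the other half of the constant `4`. -/
lemma normalized_bound_le_rateBound (hK : (kernelMatrix K id).PosSemidef) (hσ : 0 < σ)
    (hL0 : ∀ i, 0 ≤ L i) {T : ℕ} (hT : 1 ≤ T) (hσT : σ ^ 2 ≤ 1 + 2 / (T : ℝ)) :
    2 * (∑ i, L i) * Real.sqrt (beta 𝒳 m n δ T) *
      (∑ j, Real.sqrt (T * ((σ ^ 2 + 1) * (2 * infoGain K σ j T)))) / T ≤
      rateBound (𝒳 := 𝒳) K σ δ L T := by
  have hLs : 0 ≤ ∑ i, L i := Finset.sum_nonneg fun i _ => hL0 i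
  have hT0 : (0 : ℝ) < T := by exact_mod_cast hT
  have h1 : ∑ j, Real.sqrt (T * ((σ ^ 2 + 1) * (2 * infoGain K σ j T))) ≤ 2 * Psi K σ T := by
    rw [Psi, Finset.mul_sum]
    refine Finset.sum_le_sum fun j _ => ?_
    have hγ := infoGain_nonneg hK hσ j T
    refine Real.sqrt_le_iff.2 ⟨by positivity, ?_⟩
    rw [mul_pow, Real.sq_sqrt (by positivity)]
    have h2 : T * σ ^ 2 ≤ T + 2 := by
      calc T * σ ^ 2 ≤ T * (1 + 2 / (T : ℝ)) := by gcongr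
        _ = T + 2 := by field_simp
    nlinarith
  calc _ ≤ 2 * (∑ i, L i) * Real.sqrt (beta 𝒳 m n δ T) * (2 * Psi K σ T) / T := by gcongr
    _ = _ := by unfold rateBound; ring

variable (𝒳 n δ) in
lemma bound_le_log_rate (hm : 0 < m) (hK : (kernelMatrix K id).PosSemidef) (hσ : 0 < σ)
    (hδ : 0 < δ) (hL0 : ∀ i, 0 ≤ L i) {B : ℝ} (hB : 0 ≤ B) {T : ℕ} (hT : 1 ≤ T) :
    2 * (∑ i, L i) * Real.sqrt (beta 𝒳 m n δ T) *
      (∑ j, Real.sqrt (T * ((σ ^ 2 + B) * (2 * infoGain K σ j T)))) / T ≤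
      2 * (∑ i, L i) * betaConst 𝒳 m n δ * (m * Real.sqrt (2 * (σ ^ 2 + B))) *
        (1 + Real.log T) ^ 1 * Real.sqrt (infoGainMax K σ T / T) := by
  have hLs : 0 ≤ ∑ i, L i := Finset.sum_nonneg fun i _ => hL0 i
  have h3 : (1 : ℝ) ≤ T := by exact_mod_cast hT
  have hlog := Real.log_nonneg h3
  have hb0 : 0 ≤ betaConst 𝒳 m n δ := Real.sqrt_nonneg _
  have h1 := sqrt_beta_le (𝒳 := 𝒳) (n := n) hm hδ hT
  have h2 := sum_sqrt_mul_infoGain_le hm hK hσ hT (a := 2 * (σ ^ 2 + B) * T)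
    (c := 2 * (σ ^ 2 + B)) (by positivity) le_rfl
  have e1 : ∀ j, (T : ℝ) * ((σ ^ 2 + B) * (2 * infoGain K σ j T)) =
      2 * (σ ^ 2 + B) * T * infoGain K σ j T := fun j => by ring
  simp_rw [e1]
  rw [mul_div_assoc]
  calc _ ≤ 2 * (∑ i, L i) * (betaConst 𝒳 m n δ * (1 + Real.log T)) *
        (m * Real.sqrt (2 * (σ ^ 2 + B)) * Real.sqrt (infoGainMax K σ T / T)) := by gcongr
    _ = _ := by ring

end Rates

/-- Subadditivity alone is used, so neither event has to be measurable. -/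
lemma ofReal_one_sub_le_of_measure_compl_le {Ω : Type*} [MeasurableSpace Ω] {μ : Measure Ω}
    [IsProbabilityMeasure μ] {δ : ℝ} (hδ : 0 ≤ δ) {p q : Ω → Prop}
    (hp : μ {ω | ¬ p ω} ≤ ENNReal.ofReal δ) (hpq : ∀ ω, p ω → q ω) :
    ENNReal.ofReal (1 - δ) ≤ μ {ω | q ω} := by
  rw [ENNReal.ofReal_sub _ hδ, ENNReal.ofReal_one, tsub_le_iff_right, ← measure_univ (μ := μ)]
  calc μ Set.univ ≤ μ ({ω | q ω} ∪ {ω | ¬ p ω}) := by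
        refine measure_mono fun ω _ => ?_
        by_cases h : p ω
        · exact Or.inl (hpq ω h)
        · exact Or.inr h
    _ ≤ μ {ω | q ω} + μ {ω | ¬ p ω} := measure_union_le _ _
    _ ≤ _ := by gcongr

end CUQB

theorem mainTheorem2 {𝒳 : Type*} [Fintype 𝒳] [Nonempty 𝒳] [DecidableEq 𝒳] [MeasurableSpace 𝒳]
    [MeasurableSingletonClass 𝒳] {m n : ℕ} (hm : 0 < m)
    (K : 𝒳 → 𝒳 → Matrix (Fin m) (Fin m) ℝ) (hK : (CUQB.kernelMatrix K id).PosSemidef)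
    (σ δ : ℝ) (hσ : 0 < σ) (hδ0 : 0 < δ) (hδ1 : δ < 1)
    (g : Fin (n + 1) → 𝒳 → (Fin m → ℝ) → ℝ) (L : Fin (n + 1) → ℝ)
    (hL : ∀ i x y z, |g i x y - g i x z| ≤ L i * ∑ j, |y j - z j|) :
    -- the explicit bound is of order `√(γ^max_T / T)` up to logarithmic factors
    (∃ p : ℕ, CUQB.rateBound (𝒳 := 𝒳) K σ δ L =O[Filter.atTop]
      fun T : ℕ => Real.log T ^ p * Real.sqrt (CUQB.infoGainMax K σ T / T)) ∧
    ∃ (C : ℝ) (p : ℕ), ∀ {Ω : Type*} [MeasurableSpace Ω] (μ : Measure Ω) [IsProbabilityMeasure μ]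
      (h : Ω → 𝒳 → Fin m → ℝ) (ε : ℕ → Ω → Fin m → ℝ)
      (rule : (t : ℕ) → CUQB.Data 𝒳 m t → 𝒳),
      CUQB.IsGPModel μ K σ h ε → CUQB.IsCUQBRule K σ δ g rule →
      -- the explicit bound, for a normalized kernel and noise level
      ((∀ x j, K x x j j ≤ 1) →
        ENNReal.ofReal (1 - δ) ≤ μ {ω | (∃ x, CUQB.IsFeasible g (h ω) x) →
          ∀ T : ℕ, 1 ≤ T → σ ^ 2 ≤ 1 + 2 / (T : ℝ) →
            CUQB.FindsWithin K σ δ g rule (h ω) (fun t => ε t ω) T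
              (CUQB.rateBound (𝒳 := 𝒳) K σ δ L T)}) ∧
      -- the rate, without any normalization
      ENNReal.ofReal (1 - δ) ≤ μ {ω | (∃ x, CUQB.IsFeasible g (h ω) x) →
        ∀ T : ℕ, 1 ≤ T →
          CUQB.FindsWithin K σ δ g rule (h ω) (fun t => ε t ω) T
            (C * (1 + Real.log T) ^ p * Real.sqrt (CUQB.infoGainMax K σ T / T))} := by
  have hL0 := CUQB.lipschitz_const_nonneg hm hL
  refine ⟨⟨1, CUQB.rateBound_isBigO hm hK hσ hδ0 hL0⟩, ?_⟩
  have hK0 : ∀ x j, 0 ≤ K x x j j := fun x j => hK.diag_nonneg (i := (x, j))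
  -- As there are finitely many points, the sum of all prior variances serves as a bound for each.
  obtain ⟨B, hB0, hB⟩ : ∃ B : ℝ, 0 ≤ B ∧ ∀ x j, K x x j j ≤ B := by
    refine ⟨∑ x, ∑ j, K x x j j,
      Finset.sum_nonneg fun x _ => Finset.sum_nonneg fun j _ => hK0 x j, fun x j => ?_⟩
    exact (Finset.single_le_sum (f := fun j => K x x j j) (fun j _ => hK0 x j)
      (Finset.mem_univ j)).trans (Finset.single_le_sum (f := fun x => ∑ j, K x x j j)
        (fun x _ => Finset.sum_nonneg fun j _ => hK0 x j) (Finset.mem_univ x))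
  -- The constant of `bound_le_log_rate`, fixed before the probability space and the query rule are
  -- introduced.
  refine ⟨2 * (∑ i, L i) * CUQB.betaConst 𝒳 m n δ * (m * Real.sqrt (2 * (σ ^ 2 + B))), 1, ?_⟩
  intro Ω _ μ _ h ε rule hM hrule
  have hgood := hM.measure_not_confidenceHolds_le hK hσ hm hL hrule.measurable hδ0 hδ1
  refine ⟨fun hK1 => ?_, ?_⟩
  · refine CUQB.ofReal_one_sub_le_of_measure_compl_le hδ0.le hgood
      fun ω hω hfeas T hT hσT => ?_
    exact (CUQB.findsWithin_of_confidenceHolds hm hK hσ hδ0 hδ1 hL hrule.solves hω hfeas hK1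
      hT).mono (CUQB.normalized_bound_le_rateBound hK hσ hL0 hT hσT)
  · refine CUQB.ofReal_one_sub_le_of_measure_compl_le hδ0.le hgood fun ω hω hfeas T hT => ?_
    exact (CUQB.findsWithin_of_confidenceHolds hm hK hσ hδ0 hδ1 hL hrule.solves hω hfeas hB
      hT).mono (CUQB.bound_le_log_rate 𝒳 n δ hm hK hσ hδ0 hL0 hB0 hT)
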